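/- **Theorem (BvM failure in standard parameterizations).** *Model.* Let $d_x\ge 1$ and let $(u_t)_{t\ge 0}\subset\mathbb R^{d_u}$ be an arbitrary known input sequence (in particular, any persistently exciting one). Consider $$x_{t+1}=Ax_t+Bu_t+w_t,\qquad y_t=Cx_t+Du_t+z_t,\qquad x_t\in\mathbb R^{d_x},\ y_t\in\mathbb R^{d_y},$$ with independent $x_0\sim N(0,P_0)$, $w_t\sim N(0,\Sigma)$, $z_t\sim N(0,\Gamma)$, where $P_0,\Sigma\succeq 0$ and $\Gamma\succ 0$. Let $p(y_{[T]}\mid\Theta,u)$ be the likelihood of $y_{[T]}=(y_1,\dots,y_T)$, obtained by marginalizing the latent states. A system is *minimal* if $[B,AB,\dots,A^{d_x-1}B]$ and $[C^\top,(CA)^\top,\dots,(CA^{d_x-1})^\top]^\top$ have rank $d_x$. For a parameter vector $\Theta\in\mathbb R^N$, the Fisher information matrix is $I_T(\Theta)=\mathbb E_{Y_{[T]}\mid\Theta}[\nabla_\Theta\log p\,(\nabla_\Theta\log p)^\top]$. *Standard parameterizations.* - (S1) $\Theta_s$ consists of all entries of $A,B,C,D$ and of the lower triangular Cholesky factors,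 with positive diagonal, of $P_0,\Sigma,\Gamma\succ 0$. So $\dim\Theta_s=d_x^2+d_xd_u+d_yd_x+d_yd_u+d_x(d_x+1)+\tfrac12 d_y(d_y+1)$, and the parameter space is open in $\mathbb R^{\dim\Theta_s}$. - (S2) $\Theta_s$ consists of all entries of $A,B,C,D$, so $\dim\Theta_s=d_x^2+d_xd_u+d_yd_x+d_yd_u$; the state dynamics are deterministic ($\Sigma=0$, $P_0=0$) and $\Gamma\succ 0$ is known. - (S3) $\Theta_s$ consists of all entries of $A,B,C,D$, and $P_0,\Sigma\succeq 0$, $\Gamma\succ 0$ are arbitrary and known. *Claims.* Let the true parameter $\Theta^0_s$ be minimal with state dimension $d_x$. 1. The likelihood is constant along similarity orbits: for all $g\in GL(d_x)$, $T$ and $y_{[T]}$, the systems $(A,B,C,D,P_0,\Sigma,\Gamma)$ and $(g^{-1}Ag,\ g^{-1}B,\ Cg,\ D,\ g^{-1}P_0g^{-\top},\ g^{-1}\Sigma g^{-\top},\ \Gamma)$ have the same likelihood. 2. In (S1) and (S2), for every $T$, the likelihood is positive, the log-likelihood is differentiable at $\Theta^0_s$ and the score is square integrable, so $I_T(\Theta_s^0)$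 is well defined. Moreover $I_T(\Theta^0_s)$ is singular, with $$\operatorname{rank} I_T(\Theta^0_s)\le\dim\Theta_s-d_x^2 .$$ The same holds for $\lim_{T\to\infty}\frac1T I_T(\Theta^0_s)$ whenever this limit exists. 3. In (S1), (S2) and (S3) the Bernstein–von Mises conclusion fails. Let the prior have a density, and let $U\ni\Theta^0_s$ be an open set of minimal parameters on which this density is continuous and positive; in (S3) assume also that $U$ is invariant under $(A,B,C,D)\mapsto(A,-B,-C,D)$. Let $\widehat\Theta_T=\widehat\Theta_T(y_{[T]})$ be any sequence of centrings that is $\sqrt T$-consistent for $\Theta_s^0$ or, more generally, tight in $U$ (for every $\varepsilon>0$ there is a compact $K\subset U$ with $\mathbb P_{\Theta^0_s}(\widehat\Theta_T\notin K)\le\varepsilon$ for all large $T$). Then for every mean $m$ and every positive definite $V$, $$\sup_{E}\Big|P\big(\sqrt T(\Theta_s-\widehat\Theta_T)\in E\mid y_{[T]},u\big)-N(m,V)(E)\Big|$$ (supremum over measurable $E$) does not converge to $0$ in $\mathbb P_{\Theta^0_s}$-probability as $T\to\infty$. -/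

import Mathlib

open MeasureTheory ProbabilityTheory Filter Topology
open scoped ENNReal Matrix

noncomputable section

/-! ### Gaussian vectors -/

/-- The Gaussian law `N(m, S)` on `n → ℝ`; `S` is positive semidefinite and may be singular. -/
def gaussianVec {n : Type*} [Fintype n] [DecidableEq n] (m : n → ℝ) (S : Matrix n n ℝ) :
    Measure (n → ℝ) :=
  (multivariateGaussian (WithLp.toLp 2 m) S).map (WithLp.ofLp : EuclideanSpace ℝ n → (n → ℝ))

/-- The Lebesgue density at `v` of `N(0, S)`, for `S` positive definite. -/
def gaussianDensity {n : Type*} [Fintype n] [DecidableEq n] (S : Matrix n n ℝ) (v : n → ℝ) : ℝ :=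
  (Real.sqrt ((2 * Real.pi) ^ Fintype.card n * S.det))⁻¹ *
    Real.exp (-(1 / 2) * (v ⬝ᵥ (S⁻¹ *ᵥ v)))

/-! ### Linear time-invariant state-space models -/

/-- The model `x_{t+1} = A x_t + B u_t + w_t`, `y_t = C x_t + D u_t + z_t`, with `x_0 ∼ N(0, P₀)`,
`w_t ∼ N(0, Q)` and `z_t ∼ N(0, R)`. -/
structure LTISystem (dx du dy : ℕ) where
  A : Matrix (Fin dx) (Fin dx) ℝ
  B : Matrix (Fin dx) (Fin du) ℝ
  C : Matrix (Fin dy) (Fin dx) ℝ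
  D : Matrix (Fin dy) (Fin du) ℝ
  P₀ : Matrix (Fin dx) (Fin dx) ℝ
  Q : Matrix (Fin dx) (Fin dx) ℝ
  R : Matrix (Fin dy) (Fin dy) ℝ

namespace LTISystem

variable {dx du dy : ℕ}

/-- The controllability matrix `[B, A B, …, A^{dx-1} B]`. -/
def controllabilityMatrix (s : LTISystem dx du dy) : Matrix (Fin dx) (Fin dx × Fin du) ℝ :=
  Matrix.of fun i kj => (s.A ^ (kj.1 : ℕ) * s.B) i kj.2

/-- The observability matrix, with block rows `C, C A, …, C A^{dx-1}`. -/
def observabilityMatrix (s : LTISystem dx du dy) : Matrix (Fin dx × Fin dy) (Fin dx) ℝ :=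
  Matrix.of fun kj i => (s.C * s.A ^ (kj.1 : ℕ)) kj.2 i

/-- A minimal realization: controllable and observable. -/
def IsMinimal (s : LTISystem dx du dy) : Prop :=
  s.controllabilityMatrix.rank = dx ∧ s.observabilityMatrix.rank = dx

/-- The change of state coordinates `x = g x'`. -/
def similar (s : LTISystem dx du dy) (g : GL (Fin dx) ℝ) : LTISystem dx du dy where
  A := (↑g⁻¹ : Matrix (Fin dx) (Fin dx) ℝ) * s.A * (g : Matrix (Fin dx) (Fin dx) ℝ)
  B := (↑g⁻¹ : Matrix (Fin dx) (Fin dx) ℝ) * s.B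
  C := s.C * (g : Matrix (Fin dx) (Fin dx) ℝ)
  D := s.D
  P₀ := (↑g⁻¹ : Matrix (Fin dx) (Fin dx) ℝ) * s.P₀ * (↑g⁻¹ : Matrix (Fin dx) (Fin dx) ℝ)ᵀ
  Q := (↑g⁻¹ : Matrix (Fin dx) (Fin dx) ℝ) * s.Q * (↑g⁻¹ : Matrix (Fin dx) (Fin dx) ℝ)ᵀ
  R := s.R

/-- The state trajectory driven by the input `u`, the initial state `x₀` and the process
noise `w`. -/
def state (s : LTISystem dx du dy) (u : ℕ → Fin du → ℝ) (x₀ : Fin dx → ℝ)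
    (w : ℕ → Fin dx → ℝ) : ℕ → Fin dx → ℝ
  | 0 => x₀
  | t + 1 => s.A *ᵥ state s u x₀ w t + s.B *ᵥ u t + w t

/-- The initial state together with the process noise `w_0, …, w_{T-1}`. -/
abbrev Latent (dx T : ℕ) : Type := (Fin dx → ℝ) × (Fin T → Fin dx → ℝ)

/-- The joint law of the independent variables `x_0 ∼ N(0, P₀)` and `w_t ∼ N(0, Q)`, `t < T`. -/
def latentLaw (s : LTISystem dx du dy) (T : ℕ) : Measure (Latent dx T) :=
  (gaussianVec 0 s.P₀).prod (Measure.pi fun _ : Fin T => gaussianVec 0 s.Q)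

/-- The noise-free outputs `C x_t + D u_t` at the times `t = 1, …, T`; the entry with index `k`
belongs to the time `k + 1`. -/
def signal (s : LTISystem dx du dy) (u : ℕ → Fin du → ℝ) (T : ℕ) (ξ : Latent dx T) :
    Fin T → Fin dy → ℝ :=
  fun k => s.C *ᵥ s.state u ξ.1 (fun t => if h : t < T then ξ.2 ⟨t, h⟩ else 0) (k + 1) +
    s.D *ᵥ u (k + 1)

/-- The law of the outputs `y_1, …, y_T`. -/
def outputLaw (s : LTISystem dx du dy) (u : ℕ → Fin du → ℝ) (T : ℕ) :
    Measure (Fin T → Fin dy → ℝ) :=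
  ((s.latentLaw T).prod (Measure.pi fun _ : Fin T => gaussianVec 0 s.R)).map
    (fun ω => s.signal u T ω.1 + ω.2)

/-- The likelihood `p(y_1, …, y_T | s, u)`: the product of the Gaussian observation densities,
marginalized over the latent trajectory. -/
def likelihood (s : LTISystem dx du dy) (u : ℕ → Fin du → ℝ) (T : ℕ)
    (y : Fin T → Fin dy → ℝ) : ℝ :=
  ∫ ξ, ∏ k, gaussianDensity s.R (y k - s.signal u T ξ k) ∂(s.latentLaw T)

end LTISystem

/-! ### Standard parameterizations -/

/-- Coordinates of the dynamics parameters: all entries of `A`, `B`, `C` and `D`. -/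
abbrev DynIndex (dx du dy : ℕ) : Type :=
  (Fin dx × Fin dx) ⊕ (Fin dx × Fin du) ⊕ (Fin dy × Fin dx) ⊕ (Fin dy × Fin du)

/-- Coordinates of a lower triangular `n × n` matrix. -/
abbrev LowerIndex (n : ℕ) : Type := {p : Fin n × Fin n // p.2 ≤ p.1}

/-- Coordinates of the complete standard parameter: all entries of `A`, `B`, `C` and `D`, and the
entries of the Cholesky factors of the covariances of the initial state, of the process noise and
of the measurement noise. -/
abbrev StdIndex (dx du dy : ℕ) : Type :=
  DynIndex dx du dy ⊕ LowerIndex dx ⊕ LowerIndex dx ⊕ LowerIndex dy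

/-- The lower triangular matrix with the given entries. -/
def lowerMatrix {n : ℕ} (l : LowerIndex n → ℝ) : Matrix (Fin n) (Fin n) ℝ :=
  Matrix.of fun i j => if h : j ≤ i then l ⟨(i, j), h⟩ else 0

/-- The model with dynamics parameter `θ` and known noise covariances `P₀`, `Q`, `R`. -/
def dynSystem {dx du dy : ℕ} (P₀ Q : Matrix (Fin dx) (Fin dx) ℝ) (R : Matrix (Fin dy) (Fin dy) ℝ)
    (θ : DynIndex dx du dy → ℝ) : LTISystem dx du dy where
  A := Matrix.of fun i j => θ (.inl (i, j))
  B := Matrix.of fun i j => θ (.inr (.inl (i, j)))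
  C := Matrix.of fun i j => θ (.inr (.inr (.inl (i, j))))
  D := Matrix.of fun i j => θ (.inr (.inr (.inr (i, j))))
  P₀ := P₀
  Q := Q
  R := R

/-- The parameter of `(A, -B, -C, D)`, where `θ` is the parameter of `(A, B, C, D)`. -/
def signFlip {dx du dy : ℕ} (θ : DynIndex dx du dy → ℝ) : DynIndex dx du dy → ℝ
  | .inl p => θ (.inl p)
  | .inr (.inl p) => -θ (.inr (.inl p))
  | .inr (.inr (.inl p)) => -θ (.inr (.inr (.inl p)))
  | .inr (.inr (.inr p)) => θ (.inr (.inr (.inr p)))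

/-- The Cholesky factor of the initial covariance. -/
def stdLP {dx du dy : ℕ} (θ : StdIndex dx du dy → ℝ) : Matrix (Fin dx) (Fin dx) ℝ :=
  lowerMatrix fun p => θ (.inr (.inl p))

/-- The Cholesky factor of the process noise covariance. -/
def stdLQ {dx du dy : ℕ} (θ : StdIndex dx du dy → ℝ) : Matrix (Fin dx) (Fin dx) ℝ :=
  lowerMatrix fun p => θ (.inr (.inr (.inl p)))

/-- The Cholesky factor of the measurement noise covariance. -/
def stdLR {dx du dy : ℕ} (θ : StdIndex dx du dy → ℝ) : Matrix (Fin dy) (Fin dy) ℝ :=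
  lowerMatrix fun p => θ (.inr (.inr (.inr p)))

/-- The model with complete standard parameter `θ`. -/
def stdSystem {dx du dy : ℕ} (θ : StdIndex dx du dy → ℝ) : LTISystem dx du dy :=
  dynSystem (stdLP θ * (stdLP θ)ᵀ) (stdLQ θ * (stdLQ θ)ᵀ) (stdLR θ * (stdLR θ)ᵀ)
    (fun i => θ (.inl i))

/-- The complete standard parameter space: Cholesky factors have positive diagonals. -/
def stdParamSpace (dx du dy : ℕ) : Set (StdIndex dx du dy → ℝ) :=
  {θ | (∀ i, 0 < stdLP θ i i) ∧ (∀ i, 0 < stdLQ θ i i) ∧ (∀ i, 0 < stdLR θ i i)}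

/-! ### Fisher information

Below, `sys` is a parameterization: it maps a parameter vector to a model. -/

section Fisher

variable {ι : Type*} [Fintype ι] [DecidableEq ι] {dx du dy : ℕ}
  (sys : (ι → ℝ) → LTISystem dx du dy) (u : ℕ → Fin du → ℝ)

/-- The log-likelihood as a function of the parameter. -/
def logLik (T : ℕ) (y : Fin T → Fin dy → ℝ) (θ : ι → ℝ) : ℝ :=
  Real.log ((sys θ).likelihood u T y)

/-- The `i`-th component of the score, `∂ log p(y | θ, u) / ∂θ_i`. -/
def score (T : ℕ) (θ : ι → ℝ) (i : ι) (y : Fin T → Fin dy → ℝ) : ℝ :=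
  fderiv ℝ (logLik sys u T y) θ (Pi.single i 1)

/-- The Fisher information matrix `I_T(θ, u)`. -/
def fisherInformation (T : ℕ) (θ : ι → ℝ) : Matrix ι ι ℝ :=
  Matrix.of fun i j => ∫ y, score sys u T θ i y * score sys u T θ j y ∂((sys θ).outputLaw u T)

/-- The Fisher information at `θ` is well defined for every number of observations: the likelihood
is positive, the log-likelihood is differentiable and the score is square integrable. -/
def FisherRegularAt (θ : ι → ℝ) : Prop :=
  ∀ T : ℕ, (∀ y, 0 < (sys θ).likelihood u T y ∧ DifferentiableAt ℝ (logLik sys u T y) θ) ∧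
    ∀ i, MemLp (score sys u T θ i) 2 ((sys θ).outputLaw u T)

/-- At `θ`, every Fisher information matrix `I_T`, and every limit of `I_T / T` as `T → ∞`, is
singular and has rank at most the number of parameters minus `k`. -/
def FisherSingularAt (θ : ι → ℝ) (k : ℕ) : Prop :=
  (∀ T : ℕ, (fisherInformation sys u T θ).det = 0 ∧
    (fisherInformation sys u T θ).rank + k ≤ Fintype.card ι) ∧
  ∀ I : Matrix ι ι ℝ,
    Tendsto (fun T : ℕ => (T : ℝ)⁻¹ • fisherInformation sys u T θ) atTop (𝓝 I) →
      I.det = 0 ∧ I.rank + k ≤ Fintype.card ι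

end Fisher

/-! ### Posterior asymptotics -/

section Posterior

variable {ι : Type*} [Fintype ι] [DecidableEq ι] {dx du dy : ℕ}

/-- `p` is a probability density on the parameter space `S`, extended by zero. -/
structure IsPriorDensity (S : Set (ι → ℝ)) (p : (ι → ℝ) → ℝ) : Prop where
  measurable : Measurable p
  nonneg : ∀ θ, 0 ≤ p θ
  eq_zero : ∀ θ, θ ∉ S → p θ = 0
  lintegral_eq_one : ∫⁻ θ, ENNReal.ofReal (p θ) = 1

variable (sys : (ι → ℝ) → LTISystem dx du dy) (p : (ι → ℝ) → ℝ) (u : ℕ → Fin du → ℝ)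

/-- The posterior given `y_1, …, y_T`: the measure whose density is proportional to likelihood
times prior (and zero if that product has infinite integral). -/
def posteriorMeasure (T : ℕ) (y : Fin T → Fin dy → ℝ) : Measure (ι → ℝ) :=
  (∫⁻ θ, ENNReal.ofReal ((sys θ).likelihood u T y * p θ))⁻¹ •
    volume.withDensity fun θ => ENNReal.ofReal ((sys θ).likelihood u T y * p θ)

/-- The posterior law of `√T (θ - c)`. -/
def rescaledPosterior (T : ℕ) (y : Fin T → Fin dy → ℝ) (c : ι → ℝ) : Measure (ι → ℝ) :=
  (posteriorMeasure sys p u T y).map fun θ => Real.sqrt T • (θ - c)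

/-- The total variation distance `sup_E |μ(E) - ν(E)|` over measurable sets `E`. -/
def tvDistance {α : Type*} [MeasurableSpace α] (μ ν : Measure α) : ℝ :=
  ⨆ E : {E : Set α // MeasurableSet E}, |μ.real E - ν.real E|

/-- With data generated by the parameter `θ₀`, the posterior, centred at `est` and scaled by `√T`,
converges to `N(m, V)` in total variation, in probability. -/
def PosteriorConvergesToGaussian (θ₀ : ι → ℝ) (est : ∀ T : ℕ, (Fin T → Fin dy → ℝ) → ι → ℝ)
    (m : ι → ℝ) (V : Matrix ι ι ℝ) : Prop :=
  ∀ ε : ℝ, 0 < ε → Tendsto (fun T : ℕ => (sys θ₀).outputLaw u T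
    {y | ε ≤ tvDistance (rescaledPosterior sys p u T y (est T y)) (gaussianVec m V)}) atTop (𝓝 0)

/-- `√T (est - θ₀)` is bounded in probability. -/
def IsRootConsistent (θ₀ : ι → ℝ) (est : ∀ T : ℕ, (Fin T → Fin dy → ℝ) → ι → ℝ) : Prop :=
  ∀ ε : ℝ≥0∞, 0 < ε → ∃ M : ℝ, ∀ᶠ T : ℕ in atTop,
    (sys θ₀).outputLaw u T {y | M < Real.sqrt T * ‖est T y - θ₀‖} ≤ ε

/-- `est` is tight in `U`: with probability close to one it lies in a compact subset of `U`. -/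
def IsTightIn (θ₀ : ι → ℝ) (U : Set (ι → ℝ))
    (est : ∀ T : ℕ, (Fin T → Fin dy → ℝ) → ι → ℝ) : Prop :=
  ∀ ε : ℝ≥0∞, 0 < ε → ∃ K ⊆ U, IsCompact K ∧ ∀ᶠ T : ℕ in atTop,
    (sys θ₀).outputLaw u T {y | est T y ∉ K} ≤ ε

/-- `U` is an open set of parameters of minimal systems on which the prior density is continuous
and positive, and it contains the true parameter `θ₀`. -/
structure IsPriorRegularOn (θ₀ : ι → ℝ) (U : Set (ι → ℝ)) : Prop where
  isOpen : IsOpen U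
  mem : θ₀ ∈ U
  minimal : ∀ θ ∈ U, (sys θ).IsMinimal
  continuousOn : ContinuousOn p U
  pos : ∀ θ ∈ U, 0 < p θ

/-- The Bernstein–von Mises conclusion fails at `θ₀`: for no centring that is `√T`-consistent or
tight in `U`, and for no non-degenerate Gaussian law, does the rescaled posterior converge to that
law. -/
def BvMFailsAt (θ₀ : ι → ℝ) (U : Set (ι → ℝ)) : Prop :=
  ∀ est : ∀ T : ℕ, (Fin T → Fin dy → ℝ) → ι → ℝ,
    IsRootConsistent sys u θ₀ est ∨ IsTightIn sys u θ₀ U est →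
    ∀ (m : ι → ℝ) (V : Matrix ι ι ℝ), V.PosDef →
      ¬ PosteriorConvergesToGaussian sys p u θ₀ est m V

end Posterior

end

noncomputable section

/-! ### Gaussian laws and total variation -/

/-! A change of state coordinates is invisible in the outputs: it carries the latent law and the
state trajectory along, so the likelihood is constant on the orbits of `GL (Fin dx) ℝ`
(`LTISystem.likelihood_similar`). Both negative results are consequences of this symmetry.

Infinitesimal form: the log-likelihood has derivative zero along tangent vectors of the orbit. For a
controllable system the map from `X` to its tangent vector is injective
(`LTISystem.injective_dynTangent`), which yields `dx ^ 2` independent null directions of the score.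
They do not depend on `T` or on the data, so every Fisher matrix annihilates them, and so does every
limit of normalized Fisher matrices. The required regularity comes from evaluating the latent
integral: the outputs form a Gaussian vector with positive definite covariance
(`LTISystem.likelihood_eq`), so the log-density is quadratic in the outputs with coefficients
differentiable in the matrix entries. All parameterizations factor through the vector of matrix
entries, so this calculus is done once. With Cholesky coordinates the tangent vectors have to be
lifted to the factors (`exists_cholesky_tangent`); with zero latent covariances there is nothing to
lift.

Global form: let `φ` be a linear symmetry of the likelihood without fixed points on a compact set.
By change of variables the posterior mass of `φ '' B` is at least `δ` times that of `B`, with `δ`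
independent of `T` and of the data (`exists_mul_posteriorMeasure_le_image`). A posterior close to a
Gaussian at scale `1 / √T` would put almost all its mass in a small ball `B` around the centring,
but `φ '' B` is disjoint from `B` and carries a fixed fraction of that mass
(`bvMFailsAt_of_symmetries`). No asymptotics of the likelihood enter. Scalar changes of coordinates
`a • 1` suffice: they rescale the coordinates and move `C`, which is nonzero by observability. If
the covariances are free or zero, `a` is taken close to `1`; if they are known and arbitrary, `a =
-1` preserves them. -/

instance isProbabilityMeasure_gaussianVec {n : Type*} [Fintype n] [DecidableEq n] (m : n → ℝ)
    (S : Matrix n n ℝ) : IsProbabilityMeasure (gaussianVec m S) :=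
  Measure.isProbabilityMeasure_map (by fun_prop)

/-- The mass bounds make the family bounded above; without boundedness a real supremum takes the
default value `0`. Total mass at most one, rather than exactly one, is what a possibly degenerate
posterior provides. -/
lemma abs_sub_le_tvDistance {α : Type*} [MeasurableSpace α] (μ ν : Measure α)
    (hμ : μ Set.univ ≤ 1) (hν : ν Set.univ ≤ 1) {E : Set α} (hE : MeasurableSet E) :
    |μ.real E - ν.real E| ≤ tvDistance μ ν := by
  have key : ∀ (ρ : Measure α), ρ Set.univ ≤ 1 → ∀ F : Set α, 0 ≤ ρ.real F ∧ ρ.real F ≤ 1 := by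
    intro ρ hρ F
    refine ⟨measureReal_nonneg, ?_⟩
    have := ENNReal.toReal_mono ENNReal.one_ne_top ((measure_mono (Set.subset_univ F)).trans hρ)
    simpa [Measure.real] using this
  refine le_ciSup (f := fun E : {E : Set α // MeasurableSet E} => |μ.real E - ν.real E|)
    ⟨1, ?_⟩ ⟨E, hE⟩
  rintro _ ⟨F, rfl⟩
  have h1 := key μ hμ F
  have h2 := key ν hν F
  exact abs_le.2 ⟨by linarith, by linarith⟩

lemma exists_measureReal_compl_ball_lt {E : Type*} [NormedAddCommGroup E] [MeasurableSpace E]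
    [BorelSpace E] (ν : Measure E) [IsProbabilityMeasure ν] {ε : ℝ} (hε : 0 < ε) :
    ∃ M : ℝ, 0 < M ∧ ν.real (Metric.ball 0 M)ᶜ < ε := by
  have h1 : Tendsto (ν ∘ fun n : ℕ => Metric.ball (0 : E) (n + 1)) atTop
      (𝓝 (ν (⋃ n : ℕ, Metric.ball (0 : E) (n + 1)))) :=
    tendsto_measure_iUnion_atTop fun a b hab => Metric.ball_subset_ball (by gcongr)
  have h2 : (⋃ n : ℕ, Metric.ball (0 : E) (n + 1)) = Set.univ := by
    refine Set.eq_univ_of_forall fun x => Set.mem_iUnion.2 ?_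
    obtain ⟨n, hn⟩ := exists_nat_gt ‖x‖
    exact ⟨n, by simp; linarith⟩
  rw [h2, measure_univ] at h1
  have h3 : Tendsto (fun n : ℕ => ν.real (Metric.ball (0 : E) (n + 1))) atTop (𝓝 1) := by
    exact (ENNReal.tendsto_toReal ENNReal.one_ne_top).comp h1
  obtain ⟨n, hn⟩ := (h3.eventually (lt_mem_nhds (show 1 - ε < 1 by linarith))).exists
  refine ⟨n + 1, by positivity, ?_⟩
  rw [probReal_compl_eq_one_sub Metric.isOpen_ball.measurableSet]
  linarith

/-! ### Elementary properties of the model -/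

lemma gaussianDensity_nonneg {n : Type*} [Fintype n] [DecidableEq n] (S : Matrix n n ℝ)
    (v : n → ℝ) : 0 ≤ gaussianDensity S v := by
  unfold gaussianDensity; positivity

@[fun_prop]
lemma continuous_gaussianDensity {n : Type*} [Fintype n] [DecidableEq n] (S : Matrix n n ℝ) :
    Continuous (gaussianDensity S) := by
  unfold gaussianDensity; fun_prop

namespace LTISystem

variable {dx du dy : ℕ} (s : LTISystem dx du dy) (u : ℕ → Fin du → ℝ) (T : ℕ)

lemma likelihood_nonneg (y : Fin T → Fin dy → ℝ) : 0 ≤ s.likelihood u T y :=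
  integral_nonneg fun _ => Finset.prod_nonneg fun _ _ => gaussianDensity_nonneg _ _

instance : IsProbabilityMeasure (s.latentLaw T) := by
  unfold latentLaw; infer_instance

lemma continuous_state {X : Type*} [TopologicalSpace X] {x₀ : X → Fin dx → ℝ}
    {w : X → ℕ → Fin dx → ℝ} (hx : Continuous x₀) (hw : ∀ t, Continuous fun x => w x t) (t : ℕ) :
    Continuous fun x => s.state u (x₀ x) (w x) t := by
  induction t with
  | zero => exact hx
  | succ t ih =>
    have := hw t
    simp only [state]
    fun_prop

@[fun_prop]
lemma continuous_signal : Continuous (s.signal u T) := by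
  refine continuous_pi fun k => ?_
  have := s.continuous_state u (X := Latent dx T) (x₀ := Prod.fst)
    (w := fun ξ t => if h : t < T then ξ.2 ⟨t, h⟩ else 0) (by fun_prop)
    (fun t => by split_ifs <;> fun_prop) (k + 1)
  unfold signal
  fun_prop

instance : IsProbabilityMeasure (s.outputLaw u T) := by
  have : Measurable fun ω : Latent dx T × (Fin T → Fin dy → ℝ) => s.signal u T ω.1 + ω.2 :=
    Continuous.measurable (by fun_prop)
  exact Measure.isProbabilityMeasure_map this.aemeasurable

end LTISystem

/-! ### Posteriors of models with a symmetry -/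

section Symmetry

variable {ι : Type*} [Fintype ι] {dx du dy : ℕ}
  {sys : (ι → ℝ) → LTISystem dx du dy} {p : (ι → ℝ) → ℝ} {u : ℕ → Fin du → ℝ}

/-- Only an inequality: the normalizing integral may be zero or infinite, and then the posterior is
the zero measure. -/
lemma posteriorMeasure_univ_le (T : ℕ) (y : Fin T → Fin dy → ℝ) :
    posteriorMeasure sys p u T y Set.univ ≤ 1 := by
  simp only [posteriorMeasure, Measure.smul_apply, smul_eq_mul,
    withDensity_apply _ MeasurableSet.univ, Measure.restrict_univ]
  exact ENNReal.inv_mul_le_one _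

lemma rescaledPosterior_apply (T : ℕ) (y : Fin T → Fin dy → ℝ) (c : ι → ℝ)
    {E : Set (ι → ℝ)} (hE : MeasurableSet E) :
    rescaledPosterior sys p u T y c E =
      posteriorMeasure sys p u T y ((fun θ => Real.sqrt T • (θ - c)) ⁻¹' E) :=
  Measure.map_apply (by fun_prop) hE

/-- A symmetry of the likelihood moves a fixed proportion of the posterior mass of every subset of
a compact set on which the prior density is positive. -/
lemma exists_mul_posteriorMeasure_le_image {U K : Set (ι → ℝ)} (hp : ∀ θ, 0 ≤ p θ)
    (hcont : ContinuousOn p U) (hpos : ∀ θ ∈ U, 0 < p θ) (hK : IsCompact K) (hKU : K ⊆ U)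
    (φ : (ι → ℝ) ≃L[ℝ] (ι → ℝ)) (hφU : ∀ θ ∈ K, φ θ ∈ U)
    (hφ : ∀ θ T y, (sys (φ θ)).likelihood u T y = (sys θ).likelihood u T y) :
    ∃ δ : ℝ, 0 < δ ∧ ∀ T y (B : Set (ι → ℝ)), MeasurableSet B → B ⊆ K →
      ENNReal.ofReal δ * posteriorMeasure sys p u T y B ≤
        posteriorMeasure sys p u T y (φ '' B) := by
  rcases K.eq_empty_or_nonempty with rfl | hne
  · exact ⟨1, one_pos, fun T y B _ hB => by simp [Set.subset_empty_iff.1 hB]⟩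
  have hc1 : ContinuousOn (fun θ => p (φ θ)) K :=
    hcont.comp φ.continuous.continuousOn hφU
  obtain ⟨x₁, hx₁, hmin⟩ := hK.exists_isMinOn hne hc1
  obtain ⟨x₂, hx₂, hmax⟩ := hK.exists_isMaxOn hne (hcont.mono hKU)
  have ha : 0 < p (φ x₁) := hpos _ (hφU _ hx₁)
  have hb : 0 < p x₂ := hpos _ (hKU hx₂)
  set d : ℝ := |(φ : (ι → ℝ) →L[ℝ] (ι → ℝ)).det| with hd
  have hd0 : 0 < d := by
    rw [hd, abs_pos]
    exact (φ.toLinearEquiv.isUnit_det').ne_zero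
  -- The Jacobian of `φ` times the worst ratio of prior densities, the minimum of `p ∘ φ` on `K`
  -- over the maximum of `p` on `K`.
  refine ⟨d * (p (φ x₁) / p x₂), by positivity, fun T y B hB hBK => ?_⟩
  have himg : MeasurableSet (φ '' B) :=
    (φ.toHomeomorph.measurableEmbedding.measurableSet_image).2 hB
  simp only [posteriorMeasure, Measure.smul_apply, smul_eq_mul]
  -- The normalizing constant is common to both sides, so its value is irrelevant.
  rw [mul_left_comm]
  gcongr
  rw [withDensity_apply _ hB, withDensity_apply _ himg,
    lintegral_image_eq_lintegral_abs_det_fderiv_mul volume (f := ⇑φ) hB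
      (fun x _ => (φ : (ι → ℝ) →L[ℝ] (ι → ℝ)).hasFDerivWithinAt) φ.injective.injOn,
    ← lintegral_const_mul' _ _ ENNReal.ofReal_ne_top]
  refine setLIntegral_mono' hB fun θ hθ => ?_
  rw [← ENNReal.ofReal_mul (by positivity), ← ENNReal.ofReal_mul (by positivity)]
  apply ENNReal.ofReal_le_ofReal
  rw [hφ, mul_assoc, ← hd]
  gcongr _ * ?_
  have h1 : p (φ x₁) ≤ p (φ θ) := hmin (hBK hθ)
  have h2 : p θ ≤ p x₂ := hmax (hBK hθ)
  have h3 : p (φ x₁) / p x₂ * p θ ≤ p (φ θ) := by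
    rw [div_mul_eq_mul_div, div_le_iff₀ hb]
    exact mul_le_mul h1 h2 (hp _) (hp _)
  rw [mul_left_comm]
  exact mul_le_mul_of_nonneg_left h3 ((sys θ).likelihood_nonneg u T y)

/-- A closed ball of radius `r` around `θ₀` inside `U` serves as compact set: once `√T * r > M`, an
estimate outside the ball violates the bound `M`. -/
lemma IsRootConsistent.isTightIn {θ₀ : ι → ℝ} {U : Set (ι → ℝ)} (hU : IsOpen U) (hθ : θ₀ ∈ U)
    {est : ∀ T : ℕ, (Fin T → Fin dy → ℝ) → ι → ℝ} (h : IsRootConsistent sys u θ₀ est) :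
    IsTightIn sys u θ₀ U est := by
  intro ε hε
  obtain ⟨M, hM⟩ := h ε hε
  obtain ⟨r, hr, hrU⟩ := Metric.nhds_basis_closedBall.mem_iff.1 (hU.mem_nhds hθ)
  refine ⟨_, hrU, isCompact_closedBall _ _, ?_⟩
  have h1 : Tendsto (fun T : ℕ => Real.sqrt T * r) atTop atTop :=
    (Real.tendsto_sqrt_atTop.comp tendsto_natCast_atTop_atTop).atTop_mul_const hr
  filter_upwards [hM, h1.eventually_gt_atTop M, eventually_gt_atTop 0] with T hT hT' hT0
  refine (measure_mono fun y hy => ?_).trans hT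
  simp only [Metric.mem_closedBall, not_le, Set.mem_ofPred_eq, dist_eq_norm] at hy ⊢
  have : 0 < Real.sqrt T := Real.sqrt_pos.2 (by exact_mod_cast hT0)
  exact hT'.trans (mul_lt_mul_of_pos_left hy this)

/-- If compact sets of parameters near the truth can be moved away by a symmetry of the
likelihood, then the posterior does not concentrate around any point at the rate `√T`. -/
theorem bvMFailsAt_of_symmetries [DecidableEq ι] {θ₀ : ι → ℝ} {U : Set (ι → ℝ)}
    (hp : ∀ θ, 0 ≤ p θ) (hU : IsPriorRegularOn sys p θ₀ U)
    (hsymm : ∀ K ⊆ U, IsCompact K → ∃ φ : (ι → ℝ) ≃L[ℝ] (ι → ℝ), (∀ θ ∈ K, φ θ ∈ U) ∧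
      (∀ θ ∈ K, φ θ ≠ θ) ∧
      ∀ θ T y, (sys (φ θ)).likelihood u T y = (sys θ).likelihood u T y) :
    BvMFailsAt sys p u θ₀ U := by
  intro est hest m V _ hconv
  have htight : IsTightIn sys u θ₀ U est :=
    hest.elim (fun h => h.isTightIn hU.isOpen hU.mem) id
  -- It is enough to control the centring with probability one half. Thickening `K` leaves room for
  -- the shrinking balls around centrings in `K`.
  obtain ⟨K, hKU, hK, hKe⟩ := htight 2⁻¹ (by simp)
  obtain ⟨r, hr, hrU⟩ := hK.exists_cthickening_subset_open hU.isOpen hKU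
  have hK' : IsCompact (Metric.cthickening r K) := hK.cthickening
  obtain ⟨φ, hφU, hφne, hφ⟩ := hsymm _ hrU hK'
  obtain ⟨δ, hδ, hmass⟩ := exists_mul_posteriorMeasure_le_image (sys := sys) (u := u) hp
    hU.continuousOn hU.pos hK' hrU φ hφU hφ
  obtain ⟨η, hη, hsep⟩ : ∃ η : ℝ, 0 < η ∧ ∀ θ ∈ Metric.cthickening r K, η ≤ dist (φ θ) θ := by
    rcases (Metric.cthickening r K).eq_empty_or_nonempty with he | hne
    · exact ⟨1, one_pos, by simp [he]⟩
    · obtain ⟨x, hx, hmin⟩ := hK'.exists_isMinOn hne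
        (f := fun θ => dist (φ θ) θ) (by fun_prop)
      exact ⟨_, dist_pos.2 (hφne x hx), fun θ hθ => hmin hθ⟩
  -- If the distance and the Gaussian mass outside the ball are both below `ε`, then `B` has
  -- posterior mass above `1 - 2 * ε ≥ 1 / 2` and its complement has mass below `2 * ε ≤ δ / 4`. The
  -- symmetry forces the complement to have mass at least `δ / 2`.
  set ε : ℝ := min (1 / 4) (δ / 8) with hεdef
  have hε : 0 < ε := by positivity
  have hε1 : ε ≤ 1 / 4 := min_le_left _ _
  have hε2 : ε ≤ δ / 8 := min_le_right _ _
  obtain ⟨M, hM, hMν⟩ := exists_measureReal_compl_ball_lt (gaussianVec m V) hε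
  have hsqrt : Tendsto (fun T : ℕ => Real.sqrt T) atTop atTop :=
    Real.tendsto_sqrt_atTop.comp tendsto_natCast_atTop_atTop
  have hsmall : Tendsto (fun T : ℕ => M / Real.sqrt T) atTop (𝓝 0) :=
    Tendsto.const_div_atTop hsqrt M
  have hbig : ∀ᶠ T : ℕ in atTop, ∀ y, est T y ∈ K →
      ε ≤ tvDistance (rescaledPosterior sys p u T y (est T y)) (gaussianVec m V) := by
    filter_upwards [hsmall.eventually (gt_mem_nhds hr),
      hsmall.eventually (gt_mem_nhds (half_pos hη)), eventually_gt_atTop 0] with T hT1 hT2 hT0 y hy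
    have hs : 0 < Real.sqrt T := Real.sqrt_pos.2 (by exact_mod_cast hT0)
    by_contra! hlt
    set μ := posteriorMeasure sys p u T y
    set c := est T y
    set B := Metric.ball c (M / Real.sqrt T) with hB
    have hpre : (fun θ => Real.sqrt T • (θ - c)) ⁻¹' Metric.ball 0 M = B := by
      ext θ
      simp only [Set.mem_preimage, Metric.mem_ball, sub_zero, norm_smul, hB,
        Real.norm_eq_abs, abs_of_pos hs, dist_eq_norm]
      rw [lt_div_iff₀ hs, mul_comm]
    have hBK : B ⊆ Metric.cthickening r K := fun θ hθ =>
      Metric.mem_cthickening_of_dist_le θ c r K hy ((Metric.mem_ball.1 hθ).le.trans hT1.le)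
    -- Points of `B` are moved by at least `η`, while the radius of `B` is below `η / 2`.
    have hdisj : φ '' B ⊆ Bᶜ := by
      rintro _ ⟨θ, hθ, rfl⟩ hθ'
      have h1 := hsep θ (hBK hθ)
      have h2 := dist_triangle_right (φ θ) θ c
      rw [hB, Metric.mem_ball] at hθ hθ'
      linarith
    have hfin : IsFiniteMeasure μ := ⟨(posteriorMeasure_univ_le T y).trans_lt ENNReal.one_lt_top⟩
    have hρ : rescaledPosterior sys p u T y c Set.univ ≤ 1 := by
      rw [rescaledPosterior_apply T y c MeasurableSet.univ]
      exact posteriorMeasure_univ_le T y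
    have hB1 : (rescaledPosterior sys p u T y c).real (Metric.ball 0 M) = μ.real B := by
      rw [Measure.real, rescaledPosterior_apply T y c Metric.isOpen_ball.measurableSet, hpre]
      rfl
    have hB2 : (rescaledPosterior sys p u T y c).real (Metric.ball 0 M)ᶜ = μ.real Bᶜ := by
      rw [Measure.real, rescaledPosterior_apply T y c Metric.isOpen_ball.measurableSet.compl,
        Set.preimage_compl, hpre]
      rfl
    have hm : δ * μ.real B ≤ μ.real Bᶜ := by
      have h1 := (hmass T y B Metric.isOpen_ball.measurableSet hBK).trans (measure_mono hdisj)
      have h2 := ENNReal.toReal_mono (measure_ne_top μ _) h1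
      rwa [ENNReal.toReal_mul, ENNReal.toReal_ofReal hδ.le] at h2
    have ht1 := (abs_sub_le_tvDistance _ (gaussianVec m V) hρ prob_le_one
      (Metric.isOpen_ball (x := (0 : ι → ℝ)) (ε := M)).measurableSet).trans_lt hlt
    have ht2 := (abs_sub_le_tvDistance _ (gaussianVec m V) hρ prob_le_one
      (Metric.isOpen_ball (x := (0 : ι → ℝ)) (ε := M)).measurableSet.compl).trans_lt hlt
    have hν := probReal_compl_eq_one_sub (μ := gaussianVec m V)
      (Metric.isOpen_ball (x := (0 : ι → ℝ)) (ε := M)).measurableSet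
    rw [hB1, abs_lt] at ht1
    rw [hB2, abs_lt] at ht2
    have hhalf : 1 / 2 ≤ μ.real B := by linarith
    nlinarith
  -- The events "distance at least `ε`" and "centring outside `K`" cover everything, but have
  -- probabilities at most `1 / 4` and `1 / 2`. Only monotonicity and subadditivity are used, so the
  -- events need not be measurable.
  have h0 := (ENNReal.tendsto_nhds_zero.1 (hconv ε hε)) 4⁻¹ (by simp)
  obtain ⟨T, hT1, hT2, hT3⟩ := (hbig.and (h0.and hKe)).exists
  have hcov : (1 : ℝ≥0∞) ≤ 4⁻¹ + 2⁻¹ := by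
    rw [← measure_univ (μ := (sys θ₀).outputLaw u T)]
    refine (measure_mono fun y _ => ?_).trans ((measure_union_le _ _).trans (add_le_add hT2 hT3))
    by_cases hy : est T y ∈ K
    · exact Or.inl (hT1 y hy)
    · exact Or.inr hy
  have h := ENNReal.toReal_mono (by simp) hcov
  rw [ENNReal.toReal_add (by simp) (by simp)] at h
  norm_num at h

end Symmetry

/-! ### Characteristic functions and densities of Gaussian vectors -/

section GaussianVec

variable {n : Type*} [Fintype n]

/-- The characteristic function of a measure on `n → ℝ`. -/
def charFunVec (μ : Measure (n → ℝ)) (t : n → ℝ) : ℂ :=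
  ∫ x, Complex.exp ((t ⬝ᵥ x : ℝ) * Complex.I) ∂μ

/-- Every continuous linear functional on `n → ℝ` is a dot product, so this is uniqueness of the
characteristic function on the dual. -/
lemma ext_of_charFunVec {μ ν : Measure (n → ℝ)} [IsFiniteMeasure μ] [IsFiniteMeasure ν]
    (h : ∀ t, charFunVec μ t = charFunVec ν t) : μ = ν := by
  classical
  apply Measure.ext_of_charFunDual
  ext L
  have hL : ∀ x, L x = (fun i => L (Pi.single i 1)) ⬝ᵥ x := by
    intro x
    conv_lhs => rw [← Finset.univ_sum_single x, map_sum]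
    refine Finset.sum_congr rfl fun i _ => ?_
    have : Pi.single i (x i) = x i • (Pi.single i 1 : n → ℝ) := by
      rw [← Pi.single_smul]; simp
    rw [this, map_smul, smul_eq_mul, mul_comm]
  have h' := h fun i => L (Pi.single i 1)
  simp only [charFunVec, ← hL] at h'
  exact h'

variable [DecidableEq n]

lemma charFunVec_gaussianVec (m : n → ℝ) {S : Matrix n n ℝ} (hS : S.PosSemidef) (t : n → ℝ) :
    charFunVec (gaussianVec m S) t =
      Complex.exp ((t ⬝ᵥ m : ℝ) * Complex.I - (t ⬝ᵥ S *ᵥ t : ℝ) / 2) := by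
  have h := charFun_multivariateGaussian (μ := WithLp.toLp 2 m) hS (WithLp.toLp 2 t)
  rw [charFun_apply] at h
  rw [charFunVec, gaussianVec, integral_map (by fun_prop) (by fun_prop)]
  simp only [EuclideanSpace.inner_eq_star_dotProduct, star_trivial] at h
  rw [dotProduct_comm t m]
  exact h

/-- Compared through characteristic functions, because `S` and `M * S * Mᵀ` may be singular and then
there are no densities. -/
lemma map_mulVec_gaussianVec {k : Type*} [Fintype k] [DecidableEq k] (m : n → ℝ)
    {S : Matrix n n ℝ} (hS : S.PosSemidef) (M : Matrix k n ℝ) :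
    (gaussianVec m S).map (fun x => M *ᵥ x) = gaussianVec (M *ᵥ m) (M * S * Mᵀ) := by
  have hM : Continuous fun x => M *ᵥ x := by fun_prop
  have := Measure.isProbabilityMeasure_map (μ := gaussianVec m S) hM.measurable.aemeasurable
  apply ext_of_charFunVec
  intro t
  have hS' : (M * S * Mᵀ).PosSemidef := by
    simpa using hS.mul_mul_conjTranspose_same M
  rw [charFunVec_gaussianVec _ hS', charFunVec, integral_map hM.measurable.aemeasurable
    (by fun_prop)]
  have h1 := charFunVec_gaussianVec m hS (t ᵥ* M)
  rw [charFunVec] at h1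
  simp only [Matrix.dotProduct_mulVec, ← Matrix.vecMul_vecMul] at h1 ⊢
  rw [h1, ← Matrix.dotProduct_mulVec (t ᵥ* M ᵥ* S), Matrix.mulVec_transpose]

omit [DecidableEq n] in
lemma pi_gaussianReal_eq_withDensity :
    Measure.pi (fun _ : n => gaussianReal 0 1) =
      volume.withDensity fun x => ENNReal.ofReal (∏ i, gaussianPDFReal 0 1 (x i)) := by
  refine Measure.pi_eq fun s hs => ?_
  have hint : Integrable (fun x : n → ℝ => ∏ i, gaussianPDFReal 0 1 (x i))
      ((volume : Measure (n → ℝ)).restrict (Set.univ.pi s)) :=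
    (Integrable.fintype_prod fun i => integrable_gaussianPDFReal 0 1).restrict
  rw [withDensity_apply _ (MeasurableSet.univ_pi hs), ← ofReal_integral_eq_lintegral_ofReal hint
    (ae_of_all _ fun x => Finset.prod_nonneg fun i _ => gaussianPDFReal_nonneg _ _ _),
    volume_pi, Measure.restrict_pi_pi, integral_fintype_prod_eq_prod,
    ENNReal.ofReal_prod_of_nonneg fun i _ =>
      integral_nonneg fun x => gaussianPDFReal_nonneg _ _ _]
  exact Finset.prod_congr rfl fun i _ => (gaussianReal_apply_eq_integral 0 one_ne_zero _).symm

open scoped MatrixOrder in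
lemma exists_gaussianVec_eq_map (m : n → ℝ) {S : Matrix n n ℝ} (hS : S.PosSemidef) :
    ∃ L : Matrix n n ℝ, L * Lᵀ = S ∧ gaussianVec m S =
      (Measure.pi fun _ : n => gaussianReal 0 1).map (fun x => m + L *ᵥ x) := by
  refine ⟨CFC.sqrt S, ?_, ?_⟩
  · have h1 : CFC.sqrt S * CFC.sqrt S = S := CFC.sqrt_mul_sqrt_self _ hS.nonneg
    have h2 : (CFC.sqrt S)ᵀ = CFC.sqrt S := by
      have := (CFC.sqrt_nonneg S).isSelfAdjoint
      simpa [IsSelfAdjoint, Matrix.star_eq_conjTranspose] using this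
    rw [h2, h1]
  · rw [gaussianVec, multivariateGaussian, Measure.map_map (by fun_prop) (by fun_prop),
      ← map_pi_eq_stdGaussian, Measure.map_map (by fun_prop) (by fun_prop)]
    congr 1

lemma gaussianDensity_one (v : n → ℝ) :
    gaussianDensity (1 : Matrix n n ℝ) v = ∏ i, gaussianPDFReal 0 1 (v i) := by
  simp only [gaussianDensity, gaussianPDFReal, Matrix.det_one, inv_one, Matrix.one_mulVec,
    Finset.prod_mul_distrib, Finset.prod_const, Finset.card_univ, ← Real.exp_sum, dotProduct,
    Finset.mul_sum]
  congr 1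
  · rw [mul_one, NNReal.coe_one, mul_one, inv_pow, Real.sqrt_eq_rpow, Real.sqrt_eq_rpow,
      ← Real.rpow_natCast, ← Real.rpow_natCast, ← Real.rpow_mul (by positivity),
      ← Real.rpow_mul (by positivity),
      mul_comm (1 / 2 : ℝ)]
  · congr 1
    refine Finset.sum_congr rfl fun i _ => ?_
    simp; ring

/-- The substitution `v = L *ᵥ x` turns the quadratic form of `(L * Lᵀ)⁻¹` into `x ⬝ᵥ x`. This is
the pointwise form of the change of variables in `gaussianVec_eq_withDensity`. -/
lemma gaussianDensity_mulVec {S L : Matrix n n ℝ} (hL : L * Lᵀ = S) (hdet : L.det ≠ 0)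
    (x : n → ℝ) : |L.det| * gaussianDensity S (L *ᵥ x) = gaussianDensity 1 x := by
  subst hL
  have hu : IsUnit L.det := hdet.isUnit
  have hut : IsUnit Lᵀ.det := by rwa [Matrix.det_transpose]
  have h1 : (L *ᵥ x) ⬝ᵥ ((L * Lᵀ)⁻¹ *ᵥ (L *ᵥ x)) = x ⬝ᵥ x := by
    rw [Matrix.mul_inv_rev, ← Matrix.mulVec_mulVec, Matrix.mulVec_mulVec (M := L⁻¹),
      Matrix.nonsing_inv_mul _ hu, Matrix.one_mulVec, Matrix.dotProduct_mulVec,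
      ← Matrix.mulVec_transpose, Matrix.transpose_nonsing_inv, Matrix.transpose_transpose,
      Matrix.mulVec_mulVec, Matrix.nonsing_inv_mul _ hu, Matrix.one_mulVec]
  have h2 : Real.sqrt ((2 * Real.pi) ^ Fintype.card n * (L * Lᵀ).det) =
      Real.sqrt ((2 * Real.pi) ^ Fintype.card n) * |L.det| := by
    rw [Real.sqrt_mul (by positivity), Matrix.det_mul, Matrix.det_transpose, Real.sqrt_mul_self_eq_abs]
  simp only [gaussianDensity, h1, h2, Matrix.det_one, mul_one, inv_one, Matrix.one_mulVec]
  have := abs_pos.2 hdet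
  field_simp

lemma gaussianVec_eq_withDensity (m : n → ℝ) {S : Matrix n n ℝ} (hS : S.PosDef) :
    gaussianVec m S = volume.withDensity fun v => ENNReal.ofReal (gaussianDensity S (v - m)) := by
  obtain ⟨L, hLL, hmapL⟩ := exists_gaussianVec_eq_map m hS.posSemidef
  have hdet : L.det ≠ 0 := by
    intro h
    have := hS.det_pos
    rw [← hLL, Matrix.det_mul, h, zero_mul] at this
    exact this.false
  have hstd : Measure.pi (fun _ : n => gaussianReal 0 1) =
      (volume : Measure (n → ℝ)).withDensity fun x => ENNReal.ofReal (gaussianDensity 1 x) := by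
    simp only [pi_gaussianReal_eq_withDensity, gaussianDensity_one]
  have hcont : Continuous fun x : n → ℝ => L *ᵥ x := by fun_prop
  ext E hE
  rw [hmapL, Measure.map_apply (Continuous.measurable (by fun_prop)) hE, hstd,
    withDensity_apply _ (Continuous.measurable (by fun_prop) hE), withDensity_apply _ hE,
    ← lintegral_indicator (Continuous.measurable (by fun_prop) hE), ← lintegral_indicator hE]
  have hF : Measurable fun v => (E.indicator fun v => ENNReal.ofReal (gaussianDensity S (v - m))) (m + v) := by
    have : Measurable (E.indicator fun v => ENNReal.ofReal (gaussianDensity S (v - m))) :=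
      Measurable.indicator (by fun_prop) hE
    fun_prop
  rw [← lintegral_add_left_eq_self (E.indicator fun v => ENNReal.ofReal
    (gaussianDensity S (v - m))) m]
  have hmap := Real.map_matrix_volume_pi_eq_smul_volume_pi hdet
  -- Lebesgue measure is rewritten as a multiple of its own image under `L`, so that both sides
  -- become integrals over the standard coordinates.
  have h3 : (volume : Measure (n → ℝ)) =
      ENNReal.ofReal |L.det| • Measure.map (Matrix.toLin' L) volume := by
    rw [hmap, smul_smul, ← ENNReal.ofReal_mul (abs_nonneg _), ← abs_mul, mul_inv_cancel₀ hdet]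
    simp
  conv_rhs => rw [h3]
  rw [lintegral_smul_measure, lintegral_map hF (by exact hcont.measurable), smul_eq_mul,
    ← lintegral_const_mul' _ _ ENNReal.ofReal_ne_top]
  refine lintegral_congr fun x => ?_
  rw [Matrix.toLin'_apply]
  by_cases h : m + L *ᵥ x ∈ E
  · rw [Set.indicator_of_mem h, Set.indicator_of_mem (by exact h),
      ← ENNReal.ofReal_mul (abs_nonneg _), add_sub_cancel_left, gaussianDensity_mulVec hLL hdet]
  · rw [Set.indicator_of_notMem h, Set.indicator_of_notMem (by exact h), mul_zero]

lemma gaussianDensity_le {S : Matrix n n ℝ} (hS : S.PosDef) (v : n → ℝ) :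
    gaussianDensity S v ≤ (Real.sqrt ((2 * Real.pi) ^ Fintype.card n * S.det))⁻¹ := by
  refine mul_le_of_le_one_right (by positivity) (Real.exp_le_one_iff.2 ?_)
  have := hS.inv.posSemidef.dotProduct_mulVec_nonneg v
  simp only [star_trivial] at this
  linarith

/-- The density of the sum of a random vector and an independent Gaussian vector. -/
lemma integral_gaussianDensity_sub {Ω : Type*} [MeasurableSpace Ω] {ν : Measure Ω}
    [IsProbabilityMeasure ν] {h : Ω → n → ℝ} (hh : Measurable h) {R S : Matrix n n ℝ}
    (hR : R.PosDef) (hS : S.PosDef) {m : n → ℝ}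
    (hmap : (ν.prod (gaussianVec 0 R)).map (fun ω => h ω.1 + ω.2) = gaussianVec m S) (v : n → ℝ) :
    ∫ ω, gaussianDensity R (v - h ω) ∂ν = gaussianDensity S (v - m) := by
  set c : ℝ := (Real.sqrt ((2 * Real.pi) ^ Fintype.card n * R.det))⁻¹
  have hmeas : ∀ v, Measurable fun ω => gaussianDensity R (v - h ω) := fun v => by fun_prop
  have hbound : ∀ v ω, ‖gaussianDensity R (v - h ω)‖ ≤ c := fun v ω => by
    rw [Real.norm_of_nonneg (gaussianDensity_nonneg _ _)]
    exact gaussianDensity_le hR _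
  have hint : ∀ v, Integrable (fun ω => gaussianDensity R (v - h ω)) ν := fun v =>
    Integrable.of_bound (hmeas v).aestronglyMeasurable c (ae_of_all _ (hbound v))
  -- Uniqueness of densities only gives equality almost everywhere; continuity of both sides
  -- upgrades it to every `v`.
  have hcont : Continuous fun v => ∫ ω, gaussianDensity R (v - h ω) ∂ν :=
    continuous_of_dominated (fun v => (hmeas v).aestronglyMeasurable)
      (fun v => ae_of_all _ (hbound v)) (integrable_const c)
      (ae_of_all _ fun ω => by fun_prop)
  have hjoint : Measurable fun q : Ω × (n → ℝ) => ENNReal.ofReal (gaussianDensity R (q.2 - h q.1)) :=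
    by fun_prop
  have hae : (fun v => ∫ ω, gaussianDensity R (v - h ω) ∂ν) =ᵐ[volume]
      fun v => gaussianDensity S (v - m) := by
    have h1 : volume.withDensity (fun v => ENNReal.ofReal (∫ ω, gaussianDensity R (v - h ω) ∂ν)) =
        gaussianVec m S := by
      ext E hE
      have hmeas2 : Measurable fun ω : Ω × (n → ℝ) => h ω.1 + ω.2 := by fun_prop
      rw [← hmap, Measure.map_apply hmeas2 hE, Measure.prod_apply (hmeas2 hE),
        withDensity_apply _ hE]
      simp_rw [ofReal_integral_eq_lintegral_ofReal (hint _)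
        (ae_of_all _ fun ω => gaussianDensity_nonneg _ _)]
      -- By Tonelli the signal can be fixed first; what remains is the translate of the noise
      -- density by `h ω`.
      rw [lintegral_lintegral_swap (f := fun v ω => ENNReal.ofReal (gaussianDensity R (v - h ω)))
        (by exact (hjoint.comp measurable_swap).aemeasurable)]
      refine lintegral_congr fun ω => ?_
      have hpre : MeasurableSet ((fun z => h ω + z) ⁻¹' E) := measurable_const_add _ hE
      change _ = gaussianVec 0 R ((fun z => h ω + z) ⁻¹' E)
      rw [gaussianVec_eq_withDensity 0 hR, withDensity_apply _ hpre,
        ← lintegral_indicator hE, ← lintegral_indicator hpre,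
        ← lintegral_add_left_eq_self (E.indicator _) (h ω)]
      refine lintegral_congr fun z => ?_
      by_cases hz : h ω + z ∈ E
      · rw [Set.indicator_of_mem hz, Set.indicator_of_mem (by exact hz), sub_zero,
          add_sub_cancel_left]
      · rw [Set.indicator_of_notMem hz, Set.indicator_of_notMem (by exact hz)]
    rw [gaussianVec_eq_withDensity m hS] at h1
    have h2 := (withDensity_eq_iff (ENNReal.measurable_ofReal.comp hcont.measurable).aemeasurable
      (by fun_prop) ?_).1 h1
    · filter_upwards [h2] with v hv
      exact (ENNReal.ofReal_eq_ofReal_iff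
        (integral_nonneg fun ω => gaussianDensity_nonneg _ _) (gaussianDensity_nonneg _ _)).1 hv
    · have h3 := congrArg (fun ρ : Measure (n → ℝ) => ρ Set.univ) h1
      simp only [withDensity_apply _ MeasurableSet.univ, Measure.restrict_univ] at h3
      have h4 := congrArg (fun ρ : Measure (n → ℝ) => ρ Set.univ) (gaussianVec_eq_withDensity m hS)
      simp only [withDensity_apply _ MeasurableSet.univ, Measure.restrict_univ, measure_univ] at h4
      simp only [Function.comp_def, h3, ← h4]
      simp
  exact congrFun ((Continuous.ae_eq_iff_eq volume hcont (by fun_prop)).1 hae) v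

end GaussianVec

/-! ### Similarity -/

namespace LTISystem

variable {dx du dy : ℕ} (s : LTISystem dx du dy) (u : ℕ → Fin du → ℝ)

lemma state_similar (g : GL (Fin dx) ℝ) (x₀ : Fin dx → ℝ) (w : ℕ → Fin dx → ℝ) (t : ℕ) :
    (s.similar g).state u ((↑g⁻¹ : Matrix (Fin dx) (Fin dx) ℝ) *ᵥ x₀)
      (fun t => (↑g⁻¹ : Matrix (Fin dx) (Fin dx) ℝ) *ᵥ w t) t =
      (↑g⁻¹ : Matrix (Fin dx) (Fin dx) ℝ) *ᵥ s.state u x₀ w t := by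
  induction t with
  | zero => rfl
  | succ t ih =>
    simp only [state, ih]
    simp only [similar, Matrix.mulVec_add, Matrix.mulVec_mulVec]
    rw [Matrix.mul_assoc _ (g : Matrix (Fin dx) (Fin dx) ℝ), ← Units.val_mul, mul_inv_cancel,
      Units.val_one, Matrix.mul_one]

/-- The change of state coordinates on the initial state and the process noise. -/
def latentMap (g : GL (Fin dx) ℝ) (T : ℕ) (ξ : Latent dx T) : Latent dx T :=
  ((↑g⁻¹ : Matrix (Fin dx) (Fin dx) ℝ) *ᵥ ξ.1,
    fun t => (↑g⁻¹ : Matrix (Fin dx) (Fin dx) ℝ) *ᵥ ξ.2 t)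

lemma signal_similar (g : GL (Fin dx) ℝ) (T : ℕ) (ξ : Latent dx T) :
    (s.similar g).signal u T (latentMap g T ξ) = s.signal u T ξ := by
  funext k
  have h : (fun t => if h : t < T then (latentMap g T ξ).2 ⟨t, h⟩ else 0) =
      fun t => (↑g⁻¹ : Matrix (Fin dx) (Fin dx) ℝ) *ᵥ
        (if h : t < T then ξ.2 ⟨t, h⟩ else 0) := by
    funext t
    split_ifs <;> simp [latentMap]
  simp only [signal, h]
  rw [latentMap, state_similar]
  simp only [similar, Matrix.mulVec_mulVec]
  rw [Matrix.mul_assoc, ← Units.val_mul, mul_inv_cancel, Units.val_one, Matrix.mul_one]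

lemma latentLaw_similar (hP : s.P₀.PosSemidef) (hQ : s.Q.PosSemidef) (g : GL (Fin dx) ℝ) (T : ℕ) :
    (s.similar g).latentLaw T = (s.latentLaw T).map (latentMap g T) := by
  have h0 : Measurable fun x : Fin dx → ℝ => (↑g⁻¹ : Matrix (Fin dx) (Fin dx) ℝ) *ᵥ x :=
    Continuous.measurable (by fun_prop)
  have h1 := map_mulVec_gaussianVec 0 hP (↑g⁻¹ : Matrix (Fin dx) (Fin dx) ℝ)
  have h2 := map_mulVec_gaussianVec 0 hQ (↑g⁻¹ : Matrix (Fin dx) (Fin dx) ℝ)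
  rw [Matrix.mulVec_zero] at h1 h2
  have h3 := Measure.pi_map_pi (μ := fun _ : Fin T => gaussianVec 0 s.Q)
    (f := fun _ x => (↑g⁻¹ : Matrix (Fin dx) (Fin dx) ℝ) *ᵥ x) fun _ => h0.aemeasurable
  rw [h2] at h3
  unfold latentLaw
  simp only [similar]
  have h4 : Measurable fun (x : Fin T → Fin dx → ℝ) t =>
      (↑g⁻¹ : Matrix (Fin dx) (Fin dx) ℝ) *ᵥ x t := Continuous.measurable (by fun_prop)
  rw [← h1, ← h3, Measure.map_prod_map _ _ h0 h4]
  rfl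

/-- A substitution in the latent integral: the transformed latent law is the image under
`latentMap`, and the signal is unchanged along this map. No latent density is needed, so singular
covariances are allowed. -/
theorem likelihood_similar (hP : s.P₀.PosSemidef) (hQ : s.Q.PosSemidef) (g : GL (Fin dx) ℝ)
    (T : ℕ) (y : Fin T → Fin dy → ℝ) :
    (s.similar g).likelihood u T y = s.likelihood u T y := by
  have hmeas : Measurable (latentMap g T) := by
    refine Continuous.measurable ?_
    unfold latentMap
    fun_prop
  have hR : (s.similar g).R = s.R := rfl
  unfold likelihood
  rw [latentLaw_similar s hP hQ, integral_map hmeas.aemeasurable]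
  · simp only [signal_similar, hR]
  · refine (Continuous.measurable ?_).aestronglyMeasurable
    fun_prop

end LTISystem

/-! ### The output law in closed form -/

namespace LTISystem

open scoped Kronecker

variable {dx du dy : ℕ} (s : LTISystem dx du dy) (u : ℕ → Fin du → ℝ) (T : ℕ)

/-- A sequence of vectors as a single vector. -/
def flatten {T dy : ℕ} (y : Fin T → Fin dy → ℝ) : Fin T × Fin dy → ℝ := fun p => y p.1 p.2

@[fun_prop]
lemma continuous_flatten {T dy : ℕ} : Continuous (flatten (T := T) (dy := dy)) := by
  unfold flatten; fun_prop

lemma flatten_add {T dy : ℕ} (y z : Fin T → Fin dy → ℝ) :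
    flatten (y + z) = flatten y + flatten z := rfl

lemma flatten_sub {T dy : ℕ} (y z : Fin T → Fin dy → ℝ) :
    flatten (y - z) = flatten y - flatten z := rfl

/-- Superposition: the state is affine in initial state and noise, and its linear part is the system
with zero input. -/
lemma state_add (x₀ x₁ : Fin dx → ℝ) (w w' : ℕ → Fin dx → ℝ) (t : ℕ) :
    s.state u (x₀ + x₁) (w + w') t = s.state u x₀ w t + s.state 0 x₁ w' t := by
  induction t with
  | zero => rfl
  | succ t ih =>
    simp only [state, ih, Matrix.mulVec_add, Pi.add_apply, Pi.zero_apply, Matrix.mulVec_zero]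
    abel

lemma state_smul (c : ℝ) (x₀ : Fin dx → ℝ) (w : ℕ → Fin dx → ℝ) (t : ℕ) :
    s.state 0 (c • x₀) (c • w) t = c • s.state 0 x₀ w t := by
  induction t with
  | zero => rfl
  | succ t ih =>
    simp only [state, ih, Matrix.mulVec_smul, Pi.smul_apply, Pi.zero_apply, Matrix.mulVec_zero,
      smul_add, add_zero]

lemma signal_add (ξ ζ : Latent dx T) :
    s.signal u T (ξ + ζ) = s.signal u T ξ + s.signal 0 T ζ := by
  funext k
  have h : (fun t => if h : t < T then (ξ + ζ).2 ⟨t, h⟩ else 0) =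
      (fun t => if h : t < T then ξ.2 ⟨t, h⟩ else 0) +
        fun t => if h : t < T then ζ.2 ⟨t, h⟩ else 0 := by
    funext t
    by_cases ht : t < T <;> simp [ht]
  simp only [signal, Pi.add_apply, h, Prod.fst_add, state_add, Matrix.mulVec_add, Pi.zero_apply,
    Matrix.mulVec_zero]
  abel

lemma signal_smul (c : ℝ) (ξ : Latent dx T) :
    s.signal 0 T (c • ξ) = c • s.signal 0 T ξ := by
  funext k
  have h : (fun t => if h : t < T then (c • ξ).2 ⟨t, h⟩ else 0) =
      c • fun t => if h : t < T then ξ.2 ⟨t, h⟩ else 0 := by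
    funext t
    by_cases ht : t < T <;> simp [ht]
  simp only [signal, h, Prod.smul_fst, state_smul, Matrix.mulVec_smul, Pi.zero_apply,
    Matrix.mulVec_zero, add_zero, Pi.smul_apply]

/-- The linear map from the latent variables to the outputs. -/
def signalLin : Latent dx T →ₗ[ℝ] (Fin T → Fin dy → ℝ) where
  toFun := s.signal 0 T
  map_add' := s.signal_add 0 T
  map_smul' := s.signal_smul T

/-- The gain from the initial state to the outputs. -/
def initGain : Matrix (Fin T × Fin dy) (Fin dx) ℝ :=
  Matrix.of fun p j => s.signal 0 T (Pi.single j 1, 0) p.1 p.2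

/-- The gain from the process noise at time `t` to the outputs. -/
def noiseGain (t : Fin T) : Matrix (Fin T × Fin dy) (Fin dx) ℝ :=
  Matrix.of fun p j => s.signal 0 T (0, Pi.single t (Pi.single j 1)) p.1 p.2

/-- The mean of the outputs. -/
def outputMean : Fin T × Fin dy → ℝ := flatten (s.signal u T 0)

/-- The covariance of the outputs. -/
def outputCov : Matrix (Fin T × Fin dy) (Fin T × Fin dy) ℝ :=
  s.initGain T * s.P₀ * (s.initGain T)ᵀ +
    ∑ t, s.noiseGain T t * s.Q * (s.noiseGain T t)ᵀ + (1 : Matrix (Fin T) (Fin T) ℝ) ⊗ₖ s.R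

lemma latent_eq_sum (ξ : Latent dx T) :
    ξ = ∑ j, ξ.1 j • ((Pi.single j 1, 0) : Latent dx T) +
      ∑ t, ∑ j, ξ.2 t j • ((0, Pi.single t (Pi.single j 1)) : Latent dx T) := by
  refine Prod.ext ?_ ?_
  · simp only [Prod.fst_add, Prod.fst_sum, Prod.smul_fst, smul_zero, Finset.sum_const_zero,
      add_zero]
    funext i
    simp [Finset.sum_apply, Pi.single_apply]
  · simp only [Prod.snd_add, Prod.snd_sum, Prod.smul_snd, smul_zero, Finset.sum_const_zero,
      zero_add]
    funext t i
    simp only [Finset.sum_apply, Pi.smul_apply]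
    rw [Finset.sum_eq_single t]
    · simp [Pi.single_apply]
    · intro b _ hb
      simp [hb.symm]
    · simp

lemma flatten_signal (ξ : Latent dx T) :
    flatten (s.signal u T ξ) = s.outputMean u T + s.initGain T *ᵥ ξ.1 +
      ∑ t, s.noiseGain T t *ᵥ ξ.2 t := by
  have h1 : s.signal u T ξ = s.signal u T 0 + s.signalLin T ξ := by
    rw [← zero_add ξ, signal_add, zero_add]; rfl
  rw [h1, flatten_add, add_assoc]
  congr 1
  conv_lhs => rw [latent_eq_sum T ξ]
  simp only [map_add, map_sum, map_smul]
  funext p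
  simp only [flatten, signalLin, LinearMap.coe_mk, AddHom.coe_mk, Pi.add_apply, Finset.sum_apply,
    Pi.smul_apply, smul_eq_mul, Matrix.mulVec, dotProduct, initGain, noiseGain, Matrix.of_apply]
  simp only [mul_comm]

lemma integral_exp_pi_gaussianVec {k : ℕ} {S : Matrix (Fin k) (Fin k) ℝ} (hS : S.PosSemidef)
    (b : Fin T → Fin k → ℝ) :
    ∫ w : Fin T → Fin k → ℝ, Complex.exp ((∑ t, b t ⬝ᵥ w t : ℝ) * Complex.I)
      ∂(Measure.pi fun _ : Fin T => gaussianVec 0 S) =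
      Complex.exp (-(∑ t, b t ⬝ᵥ S *ᵥ b t : ℝ) / 2) := by
  simp only [Complex.ofReal_sum, Finset.sum_mul, Complex.exp_sum]
  rw [integral_fintype_prod_eq_prod
    (f := fun t x => Complex.exp ((b t ⬝ᵥ x : ℝ) * Complex.I))]
  rw [← Finset.sum_neg_distrib, Finset.sum_div, Complex.exp_sum]
  refine Finset.prod_congr rfl fun t _ => ?_
  have := charFunVec_gaussianVec 0 hS (b t)
  rw [charFunVec] at this
  rw [this]
  simp [neg_div]

lemma integral_exp_latentLaw (hP : s.P₀.PosSemidef) (hQ : s.Q.PosSemidef)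
    (a : Fin dx → ℝ) (b : Fin T → Fin dx → ℝ) :
    ∫ ξ, Complex.exp ((a ⬝ᵥ ξ.1 + ∑ t, b t ⬝ᵥ ξ.2 t : ℝ) * Complex.I) ∂(s.latentLaw T) =
      Complex.exp (-(a ⬝ᵥ s.P₀ *ᵥ a + ∑ t, b t ⬝ᵥ s.Q *ᵥ b t : ℝ) / 2) := by
  have h := charFunVec_gaussianVec 0 hP a
  rw [charFunVec] at h
  simp only [Complex.ofReal_add, add_mul, Complex.exp_add]
  rw [latentLaw, integral_prod_mul (fun x : Fin dx → ℝ => Complex.exp ((a ⬝ᵥ x : ℝ) * Complex.I))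
    fun w : Fin T → Fin dx → ℝ => Complex.exp ((∑ t, b t ⬝ᵥ w t : ℝ) * Complex.I),
    integral_exp_pi_gaussianVec T hQ, h, ← Complex.exp_add]
  congr 1
  simp
  ring

lemma dotProduct_kronecker_one {k : ℕ} (S : Matrix (Fin k) (Fin k) ℝ) (t v : Fin T × Fin k → ℝ) :
    t ⬝ᵥ ((1 : Matrix (Fin T) (Fin T) ℝ) ⊗ₖ S) *ᵥ v =
      ∑ j, (fun i => t (j, i)) ⬝ᵥ S *ᵥ fun i => v (j, i) := by
  simp only [dotProduct, Matrix.mulVec, Fintype.sum_prod_type, Matrix.kroneckerMap_apply,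
    Matrix.one_apply, ite_mul, one_mul, zero_mul]
  refine Finset.sum_congr rfl fun j _ => Finset.sum_congr rfl fun i _ => ?_
  congr 1
  rw [Finset.sum_eq_single j]
  · simp
  · intro b _ hb
    simp [hb.symm]
  · simp

lemma map_flatten_pi_gaussianVec {k : ℕ} {S : Matrix (Fin k) (Fin k) ℝ} (hS : S.PosSemidef) :
    (Measure.pi fun _ : Fin T => gaussianVec 0 S).map flatten =
      gaussianVec 0 ((1 : Matrix (Fin T) (Fin T) ℝ) ⊗ₖ S) := by
  have hf : Measurable (flatten (T := T) (dy := k)) := continuous_flatten.measurable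
  have := Measure.isProbabilityMeasure_map (μ := Measure.pi fun _ : Fin T => gaussianVec 0 S)
    hf.aemeasurable
  refine ext_of_charFunVec fun t => ?_
  rw [charFunVec_gaussianVec _ (Matrix.PosSemidef.one.kronecker hS), charFunVec,
    integral_map hf.aemeasurable (by fun_prop)]
  have h : ∀ w : Fin T → Fin k → ℝ,
      t ⬝ᵥ flatten w = ∑ j, (fun i => t (j, i)) ⬝ᵥ w j := fun w => by
    simp [dotProduct, Fintype.sum_prod_type, flatten]
  simp only [h]
  rw [integral_exp_pi_gaussianVec T hS, dotProduct_kronecker_one]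
  simp [neg_div]

/-- Independent noise at the `T` times is one Gaussian vector with block diagonal covariance. -/
lemma prod_gaussianDensity {k : ℕ} {S : Matrix (Fin k) (Fin k) ℝ} (hS : S.PosDef)
    (v : Fin T → Fin k → ℝ) :
    ∏ j, gaussianDensity S (v j) =
      gaussianDensity ((1 : Matrix (Fin T) (Fin T) ℝ) ⊗ₖ S) (flatten v) := by
  have := hS.det_pos
  simp only [gaussianDensity, Finset.prod_mul_distrib, Finset.prod_const, Finset.card_univ,
    ← Real.exp_sum, ← Finset.mul_sum]
  congr 1
  · rw [Matrix.det_kronecker, Matrix.det_one, one_pow, one_mul, Fintype.card_prod,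
      mul_comm (Fintype.card _), pow_mul, ← mul_pow, inv_pow]
    congr 1
    generalize hx : (2 * Real.pi) ^ Fintype.card (Fin k) * S.det = x
    have hx0 : 0 ≤ x := by rw [← hx]; positivity
    rw [Real.sqrt_eq_rpow, Real.sqrt_eq_rpow, ← Real.rpow_natCast, ← Real.rpow_natCast,
      ← Real.rpow_mul hx0, ← Real.rpow_mul hx0, mul_comm (1 / 2 : ℝ)]
  · rw [Matrix.inv_kronecker, inv_one, dotProduct_kronecker_one]
    rfl

/-- The measurement noise alone makes the covariance definite; the latent contributions are only
semidefinite. -/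
lemma outputCov_posDef (hP : s.P₀.PosSemidef) (hQ : s.Q.PosSemidef) (hR : s.R.PosDef) :
    (s.outputCov T).PosDef := by
  have h1 : (s.initGain T * s.P₀ * (s.initGain T)ᵀ).PosSemidef := by
    simpa using hP.mul_mul_conjTranspose_same (s.initGain T)
  have h2 : (∑ t, s.noiseGain T t * s.Q * (s.noiseGain T t)ᵀ).PosSemidef := by
    refine Matrix.posSemidef_sum _ fun t _ => ?_
    simpa using hQ.mul_mul_conjTranspose_same (s.noiseGain T t)
  exact Matrix.PosDef.posSemidef_add (h1.add h2) (Matrix.PosDef.one.kronecker hR)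

lemma dotProduct_conj {m k : Type*} [Fintype m] [Fintype k] (t : m → ℝ) (G : Matrix m k ℝ)
    (P : Matrix k k ℝ) : t ⬝ᵥ (G * P * Gᵀ) *ᵥ t = (t ᵥ* G) ⬝ᵥ P *ᵥ (t ᵥ* G) := by
  rw [← Matrix.mulVec_mulVec, ← Matrix.mulVec_mulVec, Matrix.mulVec_transpose,
    Matrix.dotProduct_mulVec]

/-- By independence the characteristic function factors over the initial state, the process noises
and the measurement noise; the exponents add up to the quadratic form of `outputCov`. -/
lemma map_signal_add_noise (hP : s.P₀.PosSemidef) (hQ : s.Q.PosSemidef) (hR : s.R.PosDef) :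
    ((s.latentLaw T).prod (gaussianVec 0 ((1 : Matrix (Fin T) (Fin T) ℝ) ⊗ₖ s.R))).map
      (fun ω => flatten (s.signal u T ω.1) + ω.2) =
      gaussianVec (s.outputMean u T) (s.outputCov T) := by
  have hf : Measurable fun ω : Latent dx T × (Fin T × Fin dy → ℝ) =>
      flatten (s.signal u T ω.1) + ω.2 := Continuous.measurable (by fun_prop)
  have := Measure.isProbabilityMeasure_map (μ := (s.latentLaw T).prod
    (gaussianVec 0 ((1 : Matrix (Fin T) (Fin T) ℝ) ⊗ₖ s.R))) hf.aemeasurable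
  refine ext_of_charFunVec fun t => ?_
  rw [charFunVec_gaussianVec _ (s.outputCov_posDef T hP hQ hR).posSemidef, charFunVec,
    integral_map hf.aemeasurable (by fun_prop)]
  have h1 : ∀ ω : Latent dx T × (Fin T × Fin dy → ℝ),
      Complex.exp ((t ⬝ᵥ (flatten (s.signal u T ω.1) + ω.2) : ℝ) * Complex.I) =
      (Complex.exp ((t ⬝ᵥ s.outputMean u T : ℝ) * Complex.I) *
        Complex.exp (((t ᵥ* s.initGain T) ⬝ᵥ ω.1.1 +
          ∑ j, (t ᵥ* s.noiseGain T j) ⬝ᵥ ω.1.2 j : ℝ) * Complex.I)) *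
        Complex.exp ((t ⬝ᵥ ω.2 : ℝ) * Complex.I) := fun ω => by
    rw [flatten_signal, ← Complex.exp_add, ← Complex.exp_add]
    congr 1
    simp only [dotProduct_add, Matrix.dotProduct_mulVec, dotProduct_sum, Complex.ofReal_add]
    ring
  have h2 := charFunVec_gaussianVec 0
    ((Matrix.PosDef.one (n := Fin T) (R := ℝ)).kronecker hR).posSemidef t
  rw [charFunVec] at h2
  simp only [h1]
  rw [integral_prod_mul (fun ξ : Latent dx T =>
    Complex.exp ((t ⬝ᵥ s.outputMean u T : ℝ) * Complex.I) *
        Complex.exp (((t ᵥ* s.initGain T) ⬝ᵥ ξ.1 +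
          ∑ j, (t ᵥ* s.noiseGain T j) ⬝ᵥ ξ.2 j : ℝ) * Complex.I))
    (fun z : Fin T × Fin dy → ℝ => Complex.exp ((t ⬝ᵥ z : ℝ) * Complex.I)), integral_const_mul,
    s.integral_exp_latentLaw T hP hQ, h2, ← Complex.exp_add, ← Complex.exp_add]
  congr 1
  simp only [outputCov, Matrix.add_mulVec, dotProduct_add, dotProduct_conj, Matrix.sum_mulVec,
    dotProduct_sum, Complex.ofReal_add, dotProduct_zero, Complex.ofReal_zero]
  ring

lemma map_flatten_outputLaw (hP : s.P₀.PosSemidef) (hQ : s.Q.PosSemidef) (hR : s.R.PosDef) :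
    (s.outputLaw u T).map flatten = gaussianVec (s.outputMean u T) (s.outputCov T) := by
  have hf : Measurable (flatten (T := T) (dy := dy)) := continuous_flatten.measurable
  rw [← s.map_signal_add_noise u T hP hQ hR, ← map_flatten_pi_gaussianVec T hR.posSemidef,
    outputLaw, Measure.map_map hf (Continuous.measurable (by fun_prop))]
  conv_rhs => rw [← Measure.map_id (μ := s.latentLaw T)]
  rw [Measure.map_prod_map _ _ measurable_id hf, Measure.map_map
    (Continuous.measurable (by fun_prop)) (measurable_id.prodMap hf)]
  rfl

/-- The likelihood is the density of a Gaussian vector. -/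
theorem likelihood_eq (hP : s.P₀.PosSemidef) (hQ : s.Q.PosSemidef) (hR : s.R.PosDef)
    (y : Fin T → Fin dy → ℝ) :
    s.likelihood u T y =
      gaussianDensity (s.outputCov T) (flatten y - s.outputMean u T) := by
  rw [← integral_gaussianDensity_sub (h := fun ξ => flatten (s.signal u T ξ))
    (Continuous.measurable (by fun_prop)) (Matrix.PosDef.one.kronecker hR)
    (s.outputCov_posDef T hP hQ hR) (s.map_signal_add_noise u T hP hQ hR), likelihood]
  refine integral_congr_ae (ae_of_all _ fun ξ => ?_)
  simp only
  rw [prod_gaussianDensity T hR, ← flatten_sub]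
  rfl

end LTISystem

/-! ### Differentiability of the log-likelihood -/

section MatrixCalculus

variable {E : Type*} [NormedAddCommGroup E] [NormedSpace ℝ E] {n m k : Type*} [Fintype n]
  {x : E}

lemma differentiableAt_mul_apply {f : E → Matrix k n ℝ} {g : E → Matrix n m ℝ}
    (hf : ∀ i j, DifferentiableAt ℝ (fun e => f e i j) x)
    (hg : ∀ i j, DifferentiableAt ℝ (fun e => g e i j) x) (i : k) (j : m) :
    DifferentiableAt ℝ (fun e => (f e * g e) i j) x := by
  simp only [Matrix.mul_apply]
  fun_prop

lemma differentiableAt_mulVec_apply {f : E → Matrix k n ℝ} {g : E → n → ℝ}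
    (hf : ∀ i j, DifferentiableAt ℝ (fun e => f e i j) x)
    (hg : ∀ i, DifferentiableAt ℝ (fun e => g e i) x) (i : k) :
    DifferentiableAt ℝ (fun e => (f e *ᵥ g e) i) x := by
  simp only [Matrix.mulVec, dotProduct]
  fun_prop

variable [DecidableEq n]

lemma differentiableAt_det {f : E → Matrix n n ℝ}
    (hf : ∀ i j, DifferentiableAt ℝ (fun e => f e i j) x) :
    DifferentiableAt ℝ (fun e => (f e).det) x := by
  simp only [Matrix.det_apply]
  fun_prop

/-- Cramer's rule: an entry of the inverse is a cofactor divided by the determinant. -/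
lemma differentiableAt_inv_apply {f : E → Matrix n n ℝ}
    (hf : ∀ i j, DifferentiableAt ℝ (fun e => f e i j) x) (hx : (f x).det ≠ 0) (i j : n) :
    DifferentiableAt ℝ (fun e => (f e)⁻¹ i j) x := by
  simp only [Matrix.inv_def, Matrix.smul_apply, smul_eq_mul, Ring.inverse_eq_inv']
  refine ((differentiableAt_det hf).inv hx).mul ?_
  simp only [Matrix.adjugate_apply]
  refine differentiableAt_det fun a b => ?_
  simp only [Matrix.updateRow_apply]
  split_ifs
  · fun_prop
  · exact hf a b

end MatrixCalculus

/-- Coordinates of a model: the entries of its seven matrices. -/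
abbrev FullIndex (dx du dy : ℕ) : Type :=
  DynIndex dx du dy ⊕ (Fin dx × Fin dx) ⊕ (Fin dx × Fin dx) ⊕ (Fin dy × Fin dy)

/-- The model with given entries of its matrices. -/
def fullSystem {dx du dy : ℕ} (c : FullIndex dx du dy → ℝ) : LTISystem dx du dy :=
  dynSystem (Matrix.of fun i j => c (.inr (.inl (i, j))))
    (Matrix.of fun i j => c (.inr (.inr (.inl (i, j)))))
    (Matrix.of fun i j => c (.inr (.inr (.inr (i, j))))) fun i => c (.inl i)

/-- The vector of all entries of the matrices of a model. -/
def LTISystem.coords {dx du dy : ℕ} (s : LTISystem dx du dy) : FullIndex dx du dy → ℝ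
  | .inl (.inl p) => s.A p.1 p.2
  | .inl (.inr (.inl p)) => s.B p.1 p.2
  | .inl (.inr (.inr (.inl p))) => s.C p.1 p.2
  | .inl (.inr (.inr (.inr p))) => s.D p.1 p.2
  | .inr (.inl p) => s.P₀ p.1 p.2
  | .inr (.inr (.inl p)) => s.Q p.1 p.2
  | .inr (.inr (.inr p)) => s.R p.1 p.2

lemma fullSystem_coords {dx du dy : ℕ} (s : LTISystem dx du dy) : fullSystem s.coords = s := rfl

section LogDensity

variable {dx du dy : ℕ} (u : ℕ → Fin du → ℝ) (T : ℕ)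

lemma differentiableAt_state (x₀ : Fin dx → ℝ) (w : ℕ → Fin dx → ℝ)
    (c : FullIndex dx du dy → ℝ) (t : ℕ) (i : Fin dx) :
    DifferentiableAt ℝ (fun c : FullIndex dx du dy → ℝ => (fullSystem c).state u x₀ w t i) c := by
  induction t generalizing i with
  | zero => simp [LTISystem.state]
  | succ t ih =>
    simp only [LTISystem.state, Pi.add_apply]
    refine ((differentiableAt_mulVec_apply ?_ ih i).add
      (differentiableAt_mulVec_apply ?_ ?_ i)).add (differentiableAt_const _)
    all_goals
      intros
      first
        | fun_prop
        | (simp only [fullSystem, dynSystem, Matrix.of_apply]; fun_prop)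

lemma differentiableAt_signal (ξ : LTISystem.Latent dx T) (c : FullIndex dx du dy → ℝ) (k : Fin T)
    (i : Fin dy) :
    DifferentiableAt ℝ (fun c : FullIndex dx du dy → ℝ => (fullSystem c).signal u T ξ k i) c := by
  simp only [LTISystem.signal, Pi.add_apply]
  refine (differentiableAt_mulVec_apply ?_ (differentiableAt_state u _ _ c _) i).add
    (differentiableAt_mulVec_apply ?_ ?_ i)
  all_goals
    intros
    first
      | fun_prop
      | (simp only [fullSystem, dynSystem, Matrix.of_apply]; fun_prop)

lemma differentiableAt_outputMean (c : FullIndex dx du dy → ℝ) (p : Fin T × Fin dy) :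
    DifferentiableAt ℝ (fun c : FullIndex dx du dy → ℝ => (fullSystem c).outputMean u T p) c :=
  differentiableAt_signal u T 0 c p.1 p.2

lemma differentiableAt_outputCov (c : FullIndex dx du dy → ℝ) (p q : Fin T × Fin dy) :
    DifferentiableAt ℝ (fun c : FullIndex dx du dy → ℝ => (fullSystem c).outputCov T p q) c := by
  simp only [LTISystem.outputCov, Matrix.add_apply, Matrix.sum_apply, Matrix.kroneckerMap_apply]
  refine ((differentiableAt_mul_apply (differentiableAt_mul_apply ?_ ?_) ?_ _ _).add
    (DifferentiableAt.fun_sum fun t _ =>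
      differentiableAt_mul_apply (differentiableAt_mul_apply ?_ ?_) ?_ _ _)).add ?_
  · exact fun i j => differentiableAt_signal 0 T _ c i.1 i.2
  · intro i j
    simp only [fullSystem, dynSystem, Matrix.of_apply]
    fun_prop
  · exact fun i j => differentiableAt_signal 0 T _ c j.1 j.2
  · exact fun i j => differentiableAt_signal 0 T _ c i.1 i.2
  · intro i j
    simp only [fullSystem, dynSystem, Matrix.of_apply]
    fun_prop
  · exact fun i j => differentiableAt_signal 0 T _ c j.1 j.2
  · simp only [fullSystem, dynSystem, Matrix.of_apply]
    fun_prop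

/-- The logarithm of the Gaussian output density, as a function of the entries of the model. -/
def logDensity (y : Fin T → Fin dy → ℝ) (c : FullIndex dx du dy → ℝ) : ℝ :=
  Real.log (gaussianDensity ((fullSystem c).outputCov T)
    (LTISystem.flatten y - (fullSystem c).outputMean u T))

/-- The expansion separates the outputs from the coefficients. Only positivity of the determinant is
assumed, as `S` stands for the covariance at arbitrary nearby matrix entries, where symmetry may
fail; hence both `S⁻¹` and its transpose appear. -/
lemma log_gaussianDensity {n : Type*} [Fintype n] [DecidableEq n] {S : Matrix n n ℝ}
    (hS : 0 < S.det) (y m : n → ℝ) :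
    Real.log (gaussianDensity S (y - m)) =
      -(1 / 2) * Real.log ((2 * Real.pi) ^ Fintype.card n * S.det) -
        1 / 2 * ∑ a, m a * (S⁻¹ *ᵥ m) a +
      ∑ a, (1 / 2 * ((S⁻¹ *ᵥ m) a + (S⁻¹ᵀ *ᵥ m) a)) * y a +
      ∑ a, ∑ b, (-(1 / 2) * S⁻¹ a b) * (y a * y b) := by
  have hpos : 0 < (2 * Real.pi) ^ Fintype.card n * S.det := by positivity
  rw [gaussianDensity, Real.log_mul (by positivity) (Real.exp_pos _).ne', Real.log_exp,
    Real.log_inv, Real.log_sqrt hpos.le]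
  have h1 : (y - m) ⬝ᵥ S⁻¹ *ᵥ (y - m) = y ⬝ᵥ S⁻¹ *ᵥ y - (S⁻¹ *ᵥ m) ⬝ᵥ y - (S⁻¹ᵀ *ᵥ m) ⬝ᵥ y +
      m ⬝ᵥ S⁻¹ *ᵥ m := by
    rw [Matrix.mulVec_sub, sub_dotProduct, dotProduct_sub, dotProduct_sub,
      Matrix.mulVec_transpose, ← Matrix.dotProduct_mulVec m, dotProduct_comm (S⁻¹ *ᵥ m) y]
    ring
  have h2 : y ⬝ᵥ S⁻¹ *ᵥ y = ∑ a, ∑ b, S⁻¹ a b * (y a * y b) := by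
    simp only [dotProduct, Matrix.mulVec, Finset.mul_sum]
    refine Finset.sum_congr rfl fun a _ => Finset.sum_congr rfl fun b _ => by ring
  rw [h1, h2]
  simp only [dotProduct, mul_add, add_mul, Finset.sum_add_distrib, mul_assoc, ← Finset.mul_sum]
  ring

/-- The logarithm of the output density is a quadratic polynomial in the outputs whose
coefficients are differentiable functions of the model. -/
lemma hasFDerivAt_logDensity {c₀ : FullIndex dx du dy → ℝ}
    (hc : ((fullSystem c₀).outputCov T).PosDef) :
    ∃ (α : (FullIndex dx du dy → ℝ) →L[ℝ] ℝ)
      (β : Fin T × Fin dy → (FullIndex dx du dy → ℝ) →L[ℝ] ℝ)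
      (γ : Fin T × Fin dy → Fin T × Fin dy → (FullIndex dx du dy → ℝ) →L[ℝ] ℝ),
      ∀ y, HasFDerivAt (logDensity u T y)
        (α + ∑ a, LTISystem.flatten y a • β a +
          ∑ a, ∑ b, (LTISystem.flatten y a * LTISystem.flatten y b) • γ a b) c₀ := by
  have hdet := hc.det_pos
  have hC := fun i j => differentiableAt_outputCov T c₀ i j
  have hM := differentiableAt_outputMean u T c₀
  have hI := differentiableAt_inv_apply hC hdet.ne'
  have hIM := differentiableAt_mulVec_apply hI hM
  have hITM := differentiableAt_mulVec_apply
    (f := fun c => ((fullSystem c).outputCov T)⁻¹ᵀ) (fun i j => hI j i) hM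
  have hD := differentiableAt_det hC
  have h0 : DifferentiableAt ℝ (fun c : FullIndex dx du dy → ℝ =>
      -(1 / 2) * Real.log ((2 * Real.pi) ^ Fintype.card (Fin T × Fin dy) *
        ((fullSystem c).outputCov T).det) -
        1 / 2 * ∑ a, (fullSystem c).outputMean u T a *
          (((fullSystem c).outputCov T)⁻¹ *ᵥ (fullSystem c).outputMean u T) a) c₀ := by
    refine DifferentiableAt.sub (((hD.const_mul _).log (by positivity)).const_mul _)
      (DifferentiableAt.const_mul (DifferentiableAt.fun_sum fun a _ => (hM a).mul (hIM a)) _)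
  have h1 : ∀ a, DifferentiableAt ℝ (fun c : FullIndex dx du dy → ℝ => 1 / 2 *
      ((((fullSystem c).outputCov T)⁻¹ *ᵥ (fullSystem c).outputMean u T) a +
        (((fullSystem c).outputCov T)⁻¹ᵀ *ᵥ (fullSystem c).outputMean u T) a)) c₀ :=
    fun a => ((hIM a).add (hITM a)).const_mul (1 / 2)
  have h2 := fun a b => (hI a b).const_mul (-(1 / 2))
  obtain ⟨α, hα⟩ := h0
  choose β hβ using h1
  choose γ hγ using h2
  refine ⟨α, β, γ, fun y => ?_⟩
  -- Positivity of the determinant is an open condition, so the expansion holds in a neighbourhood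
  -- of `c₀` and may be differentiated.
  have hev : ∀ᶠ c : FullIndex dx du dy → ℝ in 𝓝 c₀, 0 < ((fullSystem c).outputCov T).det :=
    hD.continuousAt.eventually (lt_mem_nhds hdet)
  refine HasFDerivAt.congr_of_eventuallyEq ?_
    (hev.mono fun c hc => log_gaussianDensity hc (LTISystem.flatten y) _)
  exact (hα.add (HasFDerivAt.fun_sum fun a _ =>
    (hβ a).mul_const (LTISystem.flatten y a))).add (HasFDerivAt.fun_sum fun a _ =>
      HasFDerivAt.fun_sum fun b _ => (hγ a b).mul_const _)

end LogDensity

/-! ### Regularity of the Fisher information -/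

section Regularity

lemma memLp_eval_gaussianVec {n : Type*} [Fintype n] [DecidableEq n] (m : n → ℝ)
    (S : Matrix n n ℝ) (a : n) {q : ℝ≥0∞} (hq : q ≠ ∞) :
    MemLp (fun v => v a) q (gaussianVec m S) := by
  have : IsGaussian (gaussianVec m S) :=
    inferInstanceAs (IsGaussian (Measure.map (PiLp.continuousLinearEquiv 2 ℝ fun _ : n => ℝ) _))
  exact IsGaussian.memLp_dual (gaussianVec m S) (ContinuousLinearMap.proj (R := ℝ) a) q hq

variable {ι : Type*} {dx du dy : ℕ}
  {sys : (ι → ℝ) → LTISystem dx du dy} (u : ℕ → Fin du → ℝ)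

lemma memLp_flatten_outputLaw {s : LTISystem dx du dy} (hP : s.P₀.PosSemidef)
    (hQ : s.Q.PosSemidef) (hR : s.R.PosDef) (T : ℕ) (a : Fin T × Fin dy) {q : ℝ≥0∞}
    (hq : q ≠ ∞) : MemLp (fun y => LTISystem.flatten y a) q (s.outputLaw u T) := by
  have h := memLp_eval_gaussianVec (s.outputMean u T) (s.outputCov T) a hq
  rw [← s.map_flatten_outputLaw u T hP hQ hR] at h
  exact h.comp_of_map LTISystem.continuous_flatten.measurable.aemeasurable

lemma gaussianDensity_pos {n : Type*} [Fintype n] [DecidableEq n] {S : Matrix n n ℝ}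
    (hS : S.PosDef) (v : n → ℝ) : 0 < gaussianDensity S v := by
  have := hS.det_pos
  unfold gaussianDensity
  positivity

variable (sys) in
/-- The noise covariances near `θ₀` are non-degenerate, and the model is differentiable. -/
structure IsSmoothAt (θ₀ : ι → ℝ) : Prop where
  differentiableAt : DifferentiableAt ℝ (fun θ => (sys θ).coords) θ₀
  posSemidef_P₀ : ∀ θ, (sys θ).P₀.PosSemidef
  posSemidef_Q : ∀ θ, (sys θ).Q.PosSemidef
  posDef_R : ∀ᶠ θ in 𝓝 θ₀, (sys θ).R.PosDef

variable {θ₀ : ι → ℝ} (h : IsSmoothAt sys θ₀) (T : ℕ)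

include h

lemma IsSmoothAt.outputCov_posDef : ((fullSystem (sys θ₀).coords).outputCov T).PosDef :=
  (sys θ₀).outputCov_posDef T (h.posSemidef_P₀ _) (h.posSemidef_Q _) h.posDef_R.self_of_nhds

lemma IsSmoothAt.logLik_eventuallyEq (y : Fin T → Fin dy → ℝ) :
    logLik sys u T y =ᶠ[𝓝 θ₀] fun θ => logDensity u T y (sys θ).coords := by
  filter_upwards [h.posDef_R] with θ hθ
  rw [logLik, logDensity, fullSystem_coords,
    (sys θ).likelihood_eq u T (h.posSemidef_P₀ _) (h.posSemidef_Q _) hθ]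

lemma IsSmoothAt.hasFDerivAt_logLik [Fintype ι] {y : Fin T → Fin dy → ℝ}
    {ℓ : (FullIndex dx du dy → ℝ) →L[ℝ] ℝ}
    (hℓ : HasFDerivAt (logDensity u T y) ℓ (sys θ₀).coords) :
    HasFDerivAt (logLik sys u T y) (ℓ ∘L fderiv ℝ (fun θ => (sys θ).coords) θ₀) θ₀ :=
  HasFDerivAt.congr_of_eventuallyEq
    (HasFDerivAt.comp θ₀ (g := logDensity u T y) hℓ h.differentiableAt.hasFDerivAt) (h.logLik_eventuallyEq u T y)

/-- The score is a quadratic polynomial in the outputs, and a Gaussian vector has all moments; the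
quadratic terms are in `L²` as products of two functions in `L⁴`. -/
theorem IsSmoothAt.fisherRegularAt [Fintype ι] [DecidableEq ι] : FisherRegularAt sys u θ₀ := by
  intro T
  obtain ⟨α, β, γ, hd⟩ := hasFDerivAt_logDensity u T (h.outputCov_posDef T)
  refine ⟨fun y => ⟨?_, (h.hasFDerivAt_logLik u T (hd y)).differentiableAt⟩, fun i => ?_⟩
  · rw [(sys θ₀).likelihood_eq u T (h.posSemidef_P₀ _) (h.posSemidef_Q _)
      h.posDef_R.self_of_nhds]
    exact gaussianDensity_pos (h.outputCov_posDef T) _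
  · have hs : score sys u T θ₀ i = fun y =>
        α (fderiv ℝ (fun θ => (sys θ).coords) θ₀ (Pi.single i 1)) +
        ∑ a, LTISystem.flatten y a * (β a) (fderiv ℝ (fun θ => (sys θ).coords) θ₀ (Pi.single i 1)) +
        ∑ a, ∑ b, (LTISystem.flatten y a * LTISystem.flatten y b) *
          γ a b (fderiv ℝ (fun θ => (sys θ).coords) θ₀ (Pi.single i 1)) := by
      funext y
      rw [score, (h.hasFDerivAt_logLik u T (hd y)).fderiv]
      simp
    have hm : ∀ (a : Fin T × Fin dy) {q : ℝ≥0∞}, q ≠ ∞ →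
        MemLp (fun y => LTISystem.flatten y a) q ((sys θ₀).outputLaw u T) := fun a _ hq =>
      memLp_flatten_outputLaw u (h.posSemidef_P₀ _) (h.posSemidef_Q _) h.posDef_R.self_of_nhds
        T a hq
    rw [hs]
    refine MemLp.add (MemLp.add (memLp_const _) (memLp_finsetSum _ fun a _ => ?_))
      (memLp_finsetSum _ fun a _ => memLp_finsetSum _ fun b _ => ?_)
    · exact (hm a (by simp)).mul_const _
    refine MemLp.mul_const ?_ _
    have : ENNReal.HolderTriple 4 4 2 := ⟨by
      rw [← two_mul, show (4 : ℝ≥0∞) = 2 * 2 by norm_num,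
        ENNReal.mul_inv (by simp) (by simp), ← mul_assoc,
        ENNReal.mul_inv_cancel (by simp) (by simp), one_mul]⟩
    exact MemLp.mul (hm b (q := 4) (by simp)) (hm a (q := 4) (by simp))

end Regularity

/-! ### Singularity of the Fisher information -/

section Null

variable {ι : Type*} [Fintype ι] [DecidableEq ι] {dx du dy : ℕ}
  (sys : (ι → ℝ) → LTISystem dx du dy) (u : ℕ → Fin du → ℝ)

/-- The directions in which the derivatives of all log-likelihoods vanish. -/
def nullDirections (θ₀ : ι → ℝ) : Submodule ℝ (ι → ℝ) :=
  ⨅ (T : ℕ) (y : Fin T → Fin dy → ℝ),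
    LinearMap.ker (fderiv ℝ (logLik sys u T y) θ₀ : (ι → ℝ) →ₗ[ℝ] ℝ)

variable {sys u} {θ₀ : ι → ℝ}

omit [Fintype ι] [DecidableEq ι] in
lemma mem_nullDirections {τ : ι → ℝ} :
    τ ∈ nullDirections sys u θ₀ ↔ ∀ T y, fderiv ℝ (logLik sys u T y) θ₀ τ = 0 := by
  simp [nullDirections, Submodule.mem_iInf]

lemma det_eq_zero_and_rank_add_le {M : Matrix ι ι ℝ} {W : Submodule ℝ (ι → ℝ)} {k : ℕ}
    (hk : 0 < k) (hW : k ≤ Module.finrank ℝ W) (hM : ∀ w ∈ W, M *ᵥ w = 0) :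
    M.det = 0 ∧ M.rank + k ≤ Fintype.card ι := by
  constructor
  · have hne : W ≠ ⊥ := by
      rintro rfl
      rw [finrank_bot] at hW
      omega
    obtain ⟨w, hw, hw0⟩ := Submodule.exists_mem_ne_zero_of_ne_bot hne
    exact Matrix.exists_mulVec_eq_zero_iff.1 ⟨w, hw0, hM w hw⟩
  · have h1 := LinearMap.finrank_range_add_finrank_ker M.mulVecLin
    have h2 : W ≤ LinearMap.ker M.mulVecLin := fun w hw => by
      simpa using hM w hw
    have h3 := Submodule.finrank_mono h2
    rw [Module.finrank_fintype_fun_eq_card] at h1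
    rw [Matrix.rank]
    omega

/-- Entry `i` of the product is the expectation of `score i` times the derivative of the
log-likelihood along `τ`, which vanishes for every `y`. Square integrability justifies exchanging
sum and integral. -/
lemma fisherInformation_mulVec_eq_zero (h : FisherRegularAt sys u θ₀) {τ : ι → ℝ}
    (hτ : τ ∈ nullDirections sys u θ₀) (T : ℕ) : fisherInformation sys u T θ₀ *ᵥ τ = 0 := by
  have hsum : ∀ y, ∑ j, score sys u T θ₀ j y * τ j = 0 := fun y => by
    rw [← mem_nullDirections.1 hτ T y]
    conv_rhs => rw [← Finset.univ_sum_single τ, map_sum]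
    refine Finset.sum_congr rfl fun j _ => ?_
    have : Pi.single j (τ j) = τ j • (Pi.single j 1 : ι → ℝ) := by
      rw [← Pi.single_smul]; simp
    rw [this, map_smul, smul_eq_mul, mul_comm, score]
  funext i
  have hint : ∀ j, Integrable (fun y => score sys u T θ₀ i y * score sys u T θ₀ j y)
      ((sys θ₀).outputLaw u T) := fun j => MemLp.integrable_mul ((h T).2 i) ((h T).2 j)
  simp only [Matrix.mulVec, dotProduct, fisherInformation, Matrix.of_apply, Pi.zero_apply]
  simp only [← integral_mul_const]
  rw [← integral_finsetSum _ fun j _ => (hint j).mul_const _]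
  simp only [mul_assoc, ← Finset.mul_sum, hsum, mul_zero, integral_zero]

/-- The null directions are the same for all `T`, so they lie in the kernel of any limit as well. -/
theorem fisherSingularAt_of_le_finrank (h : FisherRegularAt sys u θ₀) {k : ℕ} (hk : 0 < k)
    (hN : k ≤ Module.finrank ℝ (nullDirections sys u θ₀)) : FisherSingularAt sys u θ₀ k := by
  refine ⟨fun T => det_eq_zero_and_rank_add_le hk hN fun τ hτ =>
    fisherInformation_mulVec_eq_zero h hτ T, fun I hI =>
    det_eq_zero_and_rank_add_le hk hN fun τ hτ => ?_⟩
  have h1 : Tendsto (fun T : ℕ => ((T : ℝ)⁻¹ • fisherInformation sys u T θ₀) *ᵥ τ) atTop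
      (𝓝 (I *ᵥ τ)) :=
    ((continuous_id.matrix_mulVec continuous_const).tendsto I).comp hI
  simp only [Matrix.smul_mulVec, fisherInformation_mulVec_eq_zero h hτ, smul_zero] at h1
  exact tendsto_nhds_unique h1 tendsto_const_nhds

end Null

/-! ### Tangent spaces of similarity orbits -/

/-- The entrywise derivative of a curve of matrices. -/
def HasDerivMat {m n : Type*} (f : ℝ → Matrix m n ℝ) (f' : Matrix m n ℝ) (x : ℝ) : Prop :=
  ∀ i j, HasDerivAt (fun t => f t i j) (f' i j) x

namespace HasDerivMat

variable {m n k : Type*} {x : ℝ}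

lemma const (M : Matrix m n ℝ) : HasDerivMat (fun _ => M) 0 x :=
  fun i j => hasDerivAt_const x (M i j)

lemma transpose {f : ℝ → Matrix m n ℝ} {f' : Matrix m n ℝ} (hf : HasDerivMat f f' x) :
    HasDerivMat (fun t => (f t)ᵀ) f'ᵀ x := fun i j => hf j i

lemma mul [Fintype n] {f : ℝ → Matrix m n ℝ} {g : ℝ → Matrix n k ℝ} {f' : Matrix m n ℝ}
    {g' : Matrix n k ℝ} (hf : HasDerivMat f f' x) (hg : HasDerivMat g g' x) :
    HasDerivMat (fun t => f t * g t) (f' * g x + f x * g') x := fun i j => by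
  simp only [Matrix.mul_apply, Matrix.add_apply, ← Finset.sum_add_distrib]
  exact HasDerivAt.fun_sum fun l _ => (hf i l).mul (hg l j)

lemma congr_of_eventuallyEq {f g : ℝ → Matrix m n ℝ} {f' : Matrix m n ℝ}
    (hf : HasDerivMat f f' x) (h : ∀ᶠ t in 𝓝 x, g t = f t) : HasDerivMat g f' x :=
  fun i j => (hf i j).congr_of_eventuallyEq (h.mono fun _ ht => congrFun (congrFun ht i) j)

lemma of_eq {f : ℝ → Matrix m n ℝ} {f' g' : Matrix m n ℝ} (hf : HasDerivMat f f' x)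
    (h : f' = g') : HasDerivMat f g' x := h ▸ hf

lemma affine (M X : Matrix m n ℝ) : HasDerivMat (fun t => M + t • X) X 0 := fun i j => by
  simpa using ((hasDerivAt_id (0 : ℝ)).mul_const (X i j)).const_add (M i j)

end HasDerivMat

lemma eventually_det_one_add_smul_ne_zero {n : Type*} [Fintype n] [DecidableEq n]
    (X : Matrix n n ℝ) : ∀ᶠ t : ℝ in 𝓝 0, (1 + t • X).det ≠ 0 := by
  have h : Continuous fun t : ℝ => (1 + t • X).det := by fun_prop
  exact h.continuousAt.eventually_ne (by simp)

/-- Cramer's rule gives differentiability; the value follows by differentiating `(1 + t • X) * (1 +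
t • X)⁻¹ = 1` at `0`. -/
lemma hasDerivMat_inv_one_add_smul {n : Type*} [Fintype n] [DecidableEq n] (X : Matrix n n ℝ) :
    HasDerivMat (fun t : ℝ => (1 + t • X)⁻¹) (-X) 0 := by
  have hd : ∀ i j, DifferentiableAt ℝ (fun t : ℝ => (1 + t • X)⁻¹ i j) 0 :=
    differentiableAt_inv_apply
      (fun i j => (HasDerivMat.affine 1 X i j).differentiableAt) (by simp)
  set F : Matrix n n ℝ := Matrix.of fun i j => deriv (fun t : ℝ => (1 + t • X)⁻¹ i j) 0 with hF
  have h1 : HasDerivMat (fun t : ℝ => (1 + t • X)⁻¹) F 0 := fun i j => (hd i j).hasDerivAt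
  have h2 := (HasDerivMat.affine 1 X).mul h1
  have h3 : HasDerivMat (fun t : ℝ => (1 + t • X) * (1 + t • X)⁻¹) 0 0 :=
    (HasDerivMat.const 1).congr_of_eventuallyEq
      ((eventually_det_one_add_smul_ne_zero X).mono fun t ht => Matrix.mul_nonsing_inv _ ht.isUnit)
  have h4 : F = -X := by
    refine eq_neg_of_add_eq_zero_right ?_
    ext i j
    simpa using (h2 i j).unique (h3 i j)
  rwa [h4] at h1

namespace LTISystem

variable {dx du dy : ℕ} (s : LTISystem dx du dy)

/-- The derivative of the similarity orbit of a model in the direction `X`. -/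
def orbitTangent (X : Matrix (Fin dx) (Fin dx) ℝ) : LTISystem dx du dy where
  A := s.A * X - X * s.A
  B := -(X * s.B)
  C := s.C * X
  D := 0
  P₀ := -(X * s.P₀) - s.P₀ * Xᵀ
  Q := -(X * s.Q) - s.Q * Xᵀ
  R := 0

/-- A derivative of a curve of models, from the derivatives of the curves of matrices. -/
lemma hasDerivAt_coords {c : ℝ → LTISystem dx du dy} {c' : LTISystem dx du dy} {x : ℝ}
    (hA : HasDerivMat (fun t => (c t).A) c'.A x) (hB : HasDerivMat (fun t => (c t).B) c'.B x)
    (hC : HasDerivMat (fun t => (c t).C) c'.C x) (hD : HasDerivMat (fun t => (c t).D) c'.D x)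
    (hP : HasDerivMat (fun t => (c t).P₀) c'.P₀ x) (hQ : HasDerivMat (fun t => (c t).Q) c'.Q x)
    (hR : HasDerivMat (fun t => (c t).R) c'.R x) :
    HasDerivAt (fun t => (c t).coords) c'.coords x := by
  refine hasDerivAt_pi.2 fun i => ?_
  rcases i with (p | p | p | p) | p | p | p
  exacts [hA _ _, hB _ _, hC _ _, hD _ _, hP _ _, hQ _ _, hR _ _]

/-- The curve in the similarity orbit of a model with the changes of coordinates `1 + t X`. -/
def orbitCurve (X : Matrix (Fin dx) (Fin dx) ℝ) (t : ℝ) : LTISystem dx du dy where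
  A := (1 + t • X)⁻¹ * s.A * (1 + t • X)
  B := (1 + t • X)⁻¹ * s.B
  C := s.C * (1 + t • X)
  D := s.D
  P₀ := (1 + t • X)⁻¹ * s.P₀ * ((1 + t • X)⁻¹)ᵀ
  Q := (1 + t • X)⁻¹ * s.Q * ((1 + t • X)⁻¹)ᵀ
  R := s.R

lemma orbitCurve_zero (X : Matrix (Fin dx) (Fin dx) ℝ) : s.orbitCurve X 0 = s := by
  simp [orbitCurve]

lemma eventually_orbitCurve_eq_similar (X : Matrix (Fin dx) (Fin dx) ℝ) :
    ∀ᶠ t in 𝓝 0, ∃ g : GL (Fin dx) ℝ, s.orbitCurve X t = s.similar g := by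
  filter_upwards [eventually_det_one_add_smul_ne_zero X] with t ht
  have hu : IsUnit (1 + t • X).det := ht.isUnit
  exact ⟨⟨1 + t • X, (1 + t • X)⁻¹, Matrix.mul_nonsing_inv _ hu, Matrix.nonsing_inv_mul _ hu⟩, rfl⟩

lemma hasDerivAt_orbitCurve (X : Matrix (Fin dx) (Fin dx) ℝ) :
    HasDerivAt (fun t => (s.orbitCurve X t).coords) (s.orbitTangent X).coords 0 := by
  have h1 := HasDerivMat.affine 1 X
  have h2 := hasDerivMat_inv_one_add_smul X
  refine hasDerivAt_coords ?_ ?_ ?_ (HasDerivMat.const _) ?_ ?_ (HasDerivMat.const _)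
  · exact ((h2.mul (HasDerivMat.const s.A)).mul h1).of_eq (by simp [orbitTangent, sub_eq_add_neg, add_comm])
  · exact (h2.mul (HasDerivMat.const s.B)).of_eq (by simp [orbitTangent])
  · exact ((HasDerivMat.const s.C).mul h1).of_eq (by simp [orbitTangent])
  · exact ((h2.mul (HasDerivMat.const s.P₀)).mul h2.transpose).of_eq (by simp [orbitTangent, sub_eq_add_neg])
  · exact ((h2.mul (HasDerivMat.const s.Q)).mul h2.transpose).of_eq (by simp [orbitTangent, sub_eq_add_neg])

/-- The entries of the tangent vectors that belong to the dynamics matrices. -/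
def dynTangent : Matrix (Fin dx) (Fin dx) ℝ →ₗ[ℝ] DynIndex dx du dy → ℝ where
  toFun X i := (s.orbitTangent X).coords (.inl i)
  map_add' X Y := by
    funext i
    rcases i with p | p | p | p <;>
      simp [orbitTangent, coords, Matrix.mul_add, Matrix.add_mul] <;> ring
  map_smul' a X := by
    funext i
    rcases i with p | p | p | p <;>
      simp [orbitTangent, coords, mul_sub]

/-- The similarity orbit of a controllable model has the dimension of the group. -/
lemma injective_dynTangent (hs : s.controllabilityMatrix.rank = dx) :
    Function.Injective s.dynTangent := by
  rw [← LinearMap.ker_eq_bot, LinearMap.ker_eq_bot']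
  intro X hX
  have hA : s.A * X = X * s.A := by
    ext i j
    have := congrFun hX (.inl (i, j))
    simpa [dynTangent, orbitTangent, coords, sub_eq_zero] using this
  have hB : X * s.B = 0 := by
    ext i j
    have := congrFun hX (.inr (.inl (i, j)))
    simpa [dynTangent, orbitTangent, coords] using this
  -- A direction with zero tangent vector commutes with `A` and annihilates `B`, hence annihilates
  -- every block of the controllability matrix. Its rows then vanish by full row rank.
  have hAB : ∀ k : ℕ, X * (s.A ^ k * s.B) = 0 := fun k => by
    have : Commute X (s.A ^ k) := (show Commute X s.A from hA.symm).pow_right k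
    rw [← Matrix.mul_assoc, this.eq, Matrix.mul_assoc, hB, Matrix.mul_zero]
  have hker : LinearMap.ker s.controllabilityMatrixᵀ.mulVecLin = ⊥ := by
    have h1 := LinearMap.finrank_range_add_finrank_ker s.controllabilityMatrixᵀ.mulVecLin
    have h2 := Matrix.rank_transpose s.controllabilityMatrix
    rw [hs, Matrix.rank] at h2
    rw [h2, Module.finrank_fin_fun] at h1
    exact Submodule.finrank_eq_zero.1 (by omega)
  ext i j
  have hrow : X i ∈ LinearMap.ker s.controllabilityMatrixᵀ.mulVecLin := by
    rw [LinearMap.mem_ker, Matrix.mulVecLin_apply]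
    funext kj
    have := congrFun (congrFun (hAB kj.1) i) kj.2
    rw [Matrix.mul_apply] at this
    simpa [Matrix.mulVec, dotProduct, controllabilityMatrix, mul_comm] using this
  rw [hker, Submodule.mem_bot] at hrow
  simp [hrow]

end LTISystem

section Tangent

variable {ι : Type*} [Fintype ι] {dx du dy : ℕ}
  {sys : (ι → ℝ) → LTISystem dx du dy} (u : ℕ → Fin du → ℝ) {θ₀ : ι → ℝ}

/-- Tangent vectors of the similarity orbit are null directions. -/
lemma IsSmoothAt.mem_nullDirections (h : IsSmoothAt sys θ₀) (X : Matrix (Fin dx) (Fin dx) ℝ)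
    {τ : ι → ℝ} (hτ : HasDerivAt (fun t : ℝ => (sys (θ₀ + t • τ)).coords)
      ((sys θ₀).orbitTangent X).coords 0) : τ ∈ nullDirections sys u θ₀ := by
  rw [_root_.mem_nullDirections]
  intro T y
  obtain ⟨α, β, γ, hd⟩ := hasFDerivAt_logDensity u T (h.outputCov_posDef T)
  have hG := hd y
  set ℓ := α + ∑ a, LTISystem.flatten y a • β a +
    ∑ a, ∑ b, (LTISystem.flatten y a * LTISystem.flatten y b) • γ a b
  rw [(h.hasFDerivAt_logLik u T hG).fderiv, ContinuousLinearMap.comp_apply]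
  have hline : HasDerivAt (fun t : ℝ => θ₀ + t • τ) τ 0 := by
    simpa using ((hasDerivAt_id (0 : ℝ)).smul_const τ).const_add θ₀
  have h1 : HasDerivAt (fun t : ℝ => (sys (θ₀ + t • τ)).coords)
      (fderiv ℝ (fun θ => (sys θ).coords) θ₀ τ) 0 := by
    have h0 : HasFDerivAt (fun θ => (sys θ).coords) (fderiv ℝ (fun θ => (sys θ).coords) θ₀)
        (θ₀ + (0 : ℝ) • τ) := by
      simpa using h.differentiableAt.hasFDerivAt
    exact h0.comp_hasDerivAt 0 hline
  -- The line through `θ₀` and the orbit curve have the same velocity in matrix coordinates. The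
  -- derivative can thus be computed along the orbit, which need not stay in the image of `sys`.
  rw [h1.unique hτ]
  have h2 : HasDerivAt (fun t => logDensity u T y ((sys θ₀).orbitCurve X t).coords)
      (ℓ ((sys θ₀).orbitTangent X).coords) 0 := by
    have h0 : HasFDerivAt (logDensity u T y) ℓ ((sys θ₀).orbitCurve X 0).coords := by
      rwa [LTISystem.orbitCurve_zero]
    exact h0.comp_hasDerivAt 0 ((sys θ₀).hasDerivAt_orbitCurve X)
  have h3 : HasDerivAt (fun t => logDensity u T y ((sys θ₀).orbitCurve X t).coords) 0 0 := by
    refine (hasDerivAt_const (0 : ℝ) (Real.log ((sys θ₀).likelihood u T y))).congr_of_eventuallyEq ?_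
    filter_upwards [(sys θ₀).eventually_orbitCurve_eq_similar X] with t ⟨g, hg⟩
    have hP := h.posSemidef_P₀ θ₀
    have hQ := h.posSemidef_Q θ₀
    rw [logDensity, fullSystem_coords, hg, ← LTISystem.likelihood_eq ((sys θ₀).similar g) u T ?_ ?_
      h.posDef_R.self_of_nhds, LTISystem.likelihood_similar _ u hP hQ]
    · simpa [LTISystem.similar] using hP.mul_mul_conjTranspose_same _
    · simpa [LTISystem.similar] using hQ.mul_mul_conjTranspose_same _
  exact h2.unique h3

/-- The lift `τ` need not depend linearly on `X`, so dimensions are compared after projecting by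
`π`: the image of the null directions contains the range of the injective map `dynTangent`, which
has dimension `dx ^ 2`. -/
theorem IsSmoothAt.fisherSingularAt [DecidableEq ι] (h : IsSmoothAt sys θ₀) (hdx : 0 < dx)
    (hs : (sys θ₀).controllabilityMatrix.rank = dx)
    (π : (ι → ℝ) →ₗ[ℝ] (DynIndex dx du dy → ℝ))
    (hτ : ∀ X, ∃ τ, π τ = (sys θ₀).dynTangent X ∧
      HasDerivAt (fun t : ℝ => (sys (θ₀ + t • τ)).coords)
        ((sys θ₀).orbitTangent X).coords 0) :
    FisherSingularAt sys u θ₀ (dx ^ 2) := by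
  refine fisherSingularAt_of_le_finrank (h.fisherRegularAt u) (by positivity) ?_
  have h1 : LinearMap.range (sys θ₀).dynTangent ≤ (nullDirections sys u θ₀).map π := by
    rintro _ ⟨X, rfl⟩
    obtain ⟨τ, hτ1, hτ2⟩ := hτ X
    exact ⟨τ, h.mem_nullDirections u X hτ2, hτ1⟩
  calc dx ^ 2 = Module.finrank ℝ (Matrix (Fin dx) (Fin dx) ℝ) := by
        simp [Module.finrank_matrix, sq]
    _ = Module.finrank ℝ (LinearMap.range (sys θ₀).dynTangent) :=
        (LinearMap.finrank_range_of_inj ((sys θ₀).injective_dynTangent hs)).symm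
    _ ≤ Module.finrank ℝ ((nullDirections sys u θ₀).map π) := Submodule.finrank_mono h1
    _ ≤ _ := Submodule.finrank_map_le _ _

end Tangent

/-! ### Lower triangular matrices -/

section Lower

variable {n : ℕ}

lemma lowerMatrix_apply_of_le (l : LowerIndex n → ℝ) {i j : Fin n} (h : j ≤ i) :
    lowerMatrix l i j = l ⟨(i, j), h⟩ := by
  simp [lowerMatrix, h]

lemma lowerMatrix_apply_of_lt (l : LowerIndex n → ℝ) {i j : Fin n} (h : i < j) :
    lowerMatrix l i j = 0 := by
  simp [lowerMatrix, not_le.2 h]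

lemma lowerMatrix_add (l l' : LowerIndex n → ℝ) :
    lowerMatrix (l + l') = lowerMatrix l + lowerMatrix l' := by
  ext i j
  rcases le_or_gt j i with h | h
  · simp [lowerMatrix_apply_of_le _ h]
  · simp [lowerMatrix_apply_of_lt _ h]

lemma lowerMatrix_smul (a : ℝ) (l : LowerIndex n → ℝ) :
    lowerMatrix (a • l) = a • lowerMatrix l := by
  ext i j
  rcases le_or_gt j i with h | h
  · simp [lowerMatrix_apply_of_le _ h]
  · simp [lowerMatrix_apply_of_lt _ h]

lemma exists_lowerMatrix_eq {M : Matrix (Fin n) (Fin n) ℝ} (hM : ∀ i j, i < j → M i j = 0) :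
    ∃ l, lowerMatrix l = M := by
  refine ⟨fun p => M p.1.1 p.1.2, ?_⟩
  ext i j
  rcases le_or_gt j i with h | h
  · rw [lowerMatrix_apply_of_le _ h]
  · rw [lowerMatrix_apply_of_lt _ h, hM i j h]

lemma det_lowerMatrix_ne_zero {l : LowerIndex n → ℝ} (hl : ∀ i, 0 < lowerMatrix l i i) :
    (lowerMatrix l).det ≠ 0 := by
  rw [Matrix.det_of_isLowerTriangular _ fun i j h => lowerMatrix_apply_of_lt l h]
  exact Finset.prod_ne_zero_iff.2 fun i _ => (hl i).ne'

lemma posSemidef_self_mul_transpose (M : Matrix (Fin n) (Fin n) ℝ) : (M * Mᵀ).PosSemidef := by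
  simpa using Matrix.posSemidef_self_mul_conjTranspose M

lemma posDef_lowerMatrix_mul_transpose {l : LowerIndex n → ℝ}
    (hl : ∀ i, 0 < lowerMatrix l i i) : (lowerMatrix l * (lowerMatrix l)ᵀ).PosDef := by
  rw [(posSemidef_self_mul_transpose _).posDef_iff_det_ne_zero, Matrix.det_mul,
    Matrix.det_transpose]
  exact mul_self_ne_zero.2 (det_lowerMatrix_ne_zero hl)

/-- A tangent vector of the similarity orbit of a covariance is the derivative of a curve of
Cholesky factors. -/
lemma exists_cholesky_tangent {l : LowerIndex n → ℝ} (hl : ∀ i, 0 < lowerMatrix l i i)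
    (X : Matrix (Fin n) (Fin n) ℝ) :
    ∃ δ, lowerMatrix δ * (lowerMatrix l)ᵀ + lowerMatrix l * (lowerMatrix δ)ᵀ =
      -(X * (lowerMatrix l * (lowerMatrix l)ᵀ)) - lowerMatrix l * (lowerMatrix l)ᵀ * Xᵀ := by
  set L := lowerMatrix l with hL
  have hu : IsUnit L.det := (det_lowerMatrix_ne_zero hl).isUnit
  -- With the ansatz `lowerMatrix δ = L * N`, the equation becomes `N + Nᵀ = -(M + Mᵀ)`. It is
  -- solved by the strictly lower part of the right side plus half its diagonal; a product of lower
  -- triangular matrices is again lower triangular.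
  set M := L⁻¹ * X * L with hM
  have hLM : L * M = X * L := by
    rw [hM, ← Matrix.mul_assoc, ← Matrix.mul_assoc, Matrix.mul_nonsing_inv _ hu, Matrix.one_mul]
  set N : Matrix (Fin n) (Fin n) ℝ := Matrix.of fun i j =>
    if i < j then 0 else if i = j then -M i i else -(M i j + M j i) with hN
  have hNN : N + Nᵀ = -(M + Mᵀ) := by
    ext i j
    rcases lt_trichotomy i j with h | rfl | h
    · simp [hN, h, h.ne', h.not_gt, add_comm]
    · simp [hN]
    · simp [hN, h, h.ne', h.not_gt]
  obtain ⟨δ, hδ⟩ := exists_lowerMatrix_eq (M := L * N) fun i j hij => by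
    rw [Matrix.mul_apply]
    refine Finset.sum_eq_zero fun k _ => ?_
    rcases lt_or_ge i k with h | h
    · rw [hL, lowerMatrix_apply_of_lt l h, zero_mul]
    · simp [hN, h.trans_lt hij]
  refine ⟨δ, ?_⟩
  clear_value M N
  calc lowerMatrix δ * Lᵀ + L * (lowerMatrix δ)ᵀ = L * (N + Nᵀ) * Lᵀ := by
        rw [hδ, Matrix.transpose_mul, Matrix.mul_add, Matrix.add_mul, ← Matrix.mul_assoc]
    _ = -(L * M * Lᵀ) - L * (L * M)ᵀ := by
        rw [hNN, Matrix.transpose_mul L M]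
        simp only [Matrix.mul_neg, Matrix.neg_mul, Matrix.mul_add, Matrix.add_mul,
          ← Matrix.mul_assoc]
        abel
    _ = _ := by
        rw [hLM, Matrix.transpose_mul]
        simp only [← Matrix.mul_assoc]

end Lower

/-! ### The standard parameterizations -/

section Standard

variable {dx du dy : ℕ} (u : ℕ → Fin du → ℝ)

lemma isSmoothAt_dynSystem {P₀ Q : Matrix (Fin dx) (Fin dx) ℝ} {R : Matrix (Fin dy) (Fin dy) ℝ}
    (hP : P₀.PosSemidef) (hQ : Q.PosSemidef) (hR : R.PosDef) (θ₀ : DynIndex dx du dy → ℝ) :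
    IsSmoothAt (dynSystem P₀ Q R) θ₀ where
  differentiableAt := by
    refine differentiableAt_pi.2 fun i => ?_
    rcases i with (p | p | p | p) | p | p | p <;>
      simp only [LTISystem.coords, dynSystem, Matrix.of_apply] <;> fun_prop
  posSemidef_P₀ _ := hP
  posSemidef_Q _ := hQ
  posDef_R := Eventually.of_forall fun _ => hR

lemma differentiable_lowerMatrix_apply {ι : Type*} [Fintype ι] {n : ℕ} (f : LowerIndex n → ι)
    (θ₀ : ι → ℝ) (i j : Fin n) :
    DifferentiableAt ℝ (fun θ : ι → ℝ => lowerMatrix (fun p => θ (f p)) i j) θ₀ := by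
  rcases le_or_gt j i with h | h
  · simp only [lowerMatrix_apply_of_le _ h]
    fun_prop
  · simp only [lowerMatrix_apply_of_lt _ h]
    fun_prop

lemma isSmoothAt_stdSystem {θ₀ : StdIndex dx du dy → ℝ} (hθ : θ₀ ∈ stdParamSpace dx du dy) :
    IsSmoothAt stdSystem θ₀ where
  differentiableAt := by
    refine differentiableAt_pi.2 fun i => ?_
    have hd : ∀ {n : ℕ} (f : LowerIndex n → StdIndex dx du dy) (i j : Fin n),
        DifferentiableAt ℝ (fun θ : StdIndex dx du dy → ℝ =>
          (lowerMatrix (fun p => θ (f p)) * (lowerMatrix fun p => θ (f p))ᵀ) i j) θ₀ :=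
      fun f i j => differentiableAt_mul_apply (differentiable_lowerMatrix_apply f θ₀)
        (fun i j => differentiable_lowerMatrix_apply f θ₀ j i) i j
    rcases i with (p | p | p | p) | p | p | p
    exacts [differentiableAt_apply _ _, differentiableAt_apply _ _, differentiableAt_apply _ _,
      differentiableAt_apply _ _, hd _ _ _, hd _ _ _, hd _ _ _]
  posSemidef_P₀ _ := posSemidef_self_mul_transpose _
  posSemidef_Q _ := posSemidef_self_mul_transpose _
  posDef_R := by
    have h : ∀ i, ∀ᶠ θ in 𝓝 θ₀, 0 < stdLR θ i i := fun i =>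
      (differentiable_lowerMatrix_apply _ θ₀ i i).continuousAt.eventually (lt_mem_nhds (hθ.2.2 i))
    filter_upwards [eventually_all.2 h] with θ hθ'
    exact posDef_lowerMatrix_mul_transpose hθ'

lemma hasDerivMat_lowerMatrix_mul_transpose {n : ℕ} (l δ : LowerIndex n → ℝ) :
    HasDerivMat (fun t : ℝ => lowerMatrix (l + t • δ) * (lowerMatrix (l + t • δ))ᵀ)
      (lowerMatrix δ * (lowerMatrix l)ᵀ + lowerMatrix l * (lowerMatrix δ)ᵀ) 0 := by
  have h : HasDerivMat (fun t : ℝ => lowerMatrix (l + t • δ)) (lowerMatrix δ) 0 := by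
    simp only [lowerMatrix_add, lowerMatrix_smul]
    exact HasDerivMat.affine _ _
  exact (h.mul h.transpose).of_eq (by simp)

lemma hasDerivMat_dynSystem {P₀ Q : Matrix (Fin dx) (Fin dx) ℝ} {R : Matrix (Fin dy) (Fin dy) ℝ}
    (θ₀ τ : DynIndex dx du dy → ℝ) :
    HasDerivMat (fun t => (dynSystem P₀ Q R (θ₀ + t • τ)).A) (dynSystem P₀ Q R τ).A 0 ∧
    HasDerivMat (fun t => (dynSystem P₀ Q R (θ₀ + t • τ)).B) (dynSystem P₀ Q R τ).B 0 ∧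
    HasDerivMat (fun t => (dynSystem P₀ Q R (θ₀ + t • τ)).C) (dynSystem P₀ Q R τ).C 0 ∧
    HasDerivMat (fun t => (dynSystem P₀ Q R (θ₀ + t • τ)).D) (dynSystem P₀ Q R τ).D 0 :=
  ⟨HasDerivMat.affine (dynSystem P₀ Q R θ₀).A (dynSystem P₀ Q R τ).A,
    HasDerivMat.affine (dynSystem P₀ Q R θ₀).B (dynSystem P₀ Q R τ).B,
    HasDerivMat.affine (dynSystem P₀ Q R θ₀).C (dynSystem P₀ Q R τ).C,
    HasDerivMat.affine (dynSystem P₀ Q R θ₀).D (dynSystem P₀ Q R τ).D⟩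

/-- Zero latent covariances are fixed by all changes of coordinates, so the orbit stays inside the
parameterization and its tangent vectors need no correction. -/
theorem fisherSingularAt_dynSystem (hdx : 0 < dx) {R : Matrix (Fin dy) (Fin dy) ℝ}
    (hR : R.PosDef) {θ₀ : DynIndex dx du dy → ℝ} (hθ : (dynSystem 0 0 R θ₀).IsMinimal) :
    FisherSingularAt (dynSystem 0 0 R) u θ₀ (dx ^ 2) := by
  refine (isSmoothAt_dynSystem Matrix.PosSemidef.zero Matrix.PosSemidef.zero hR
    θ₀).fisherSingularAt u hdx hθ.1 LinearMap.id fun X => ⟨_, rfl, ?_⟩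
  obtain ⟨hA, hB, hC, hD⟩ := hasDerivMat_dynSystem (P₀ := 0) (Q := 0) (R := R) θ₀
    ((dynSystem 0 0 R θ₀).dynTangent X)
  exact LTISystem.hasDerivAt_coords hA hB hC hD
    ((HasDerivMat.const _).of_eq (by simp [LTISystem.orbitTangent, dynSystem]))
    ((HasDerivMat.const _).of_eq (by simp [LTISystem.orbitTangent, dynSystem]))
    (HasDerivMat.const _)

/-- The Cholesky coordinates of the latent covariances absorb the motion along the orbit; the
measurement noise factor stays fixed. -/
theorem fisherSingularAt_stdSystem (hdx : 0 < dx) {θ₀ : StdIndex dx du dy → ℝ}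
    (hθ : θ₀ ∈ stdParamSpace dx du dy) (hmin : (stdSystem θ₀).IsMinimal) :
    FisherSingularAt stdSystem u θ₀ (dx ^ 2) := by
  refine (isSmoothAt_stdSystem hθ).fisherSingularAt u hdx hmin.1
    (LinearMap.funLeft ℝ ℝ Sum.inl) fun X => ?_
  obtain ⟨δP, hδP⟩ := exists_cholesky_tangent hθ.1 X
  obtain ⟨δQ, hδQ⟩ := exists_cholesky_tangent hθ.2.1 X
  refine ⟨Sum.elim ((stdSystem θ₀).dynTangent X) (Sum.elim δP (Sum.elim δQ 0)), rfl, ?_⟩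
  obtain ⟨hA, hB, hC, hD⟩ := hasDerivMat_dynSystem (P₀ := 0) (Q := 0)
    (R := (0 : Matrix (Fin dy) (Fin dy) ℝ)) (fun i => θ₀ (.inl i)) ((stdSystem θ₀).dynTangent X)
  refine LTISystem.hasDerivAt_coords hA hB hC hD ?_ ?_ ?_
  · exact (hasDerivMat_lowerMatrix_mul_transpose _ δP).of_eq hδP
  · exact (hasDerivMat_lowerMatrix_mul_transpose _ δQ).of_eq hδQ
  · refine (hasDerivMat_lowerMatrix_mul_transpose (fun p => θ₀ (.inr (.inr (.inr p)))) 0).of_eq ?_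
    have : lowerMatrix (0 : LowerIndex dy → ℝ) = 0 := by
      ext i j
      simp [lowerMatrix]
    simp [this, LTISystem.orbitTangent]

/-! ### Scalar changes of coordinates -/

lemma LTISystem.IsMinimal.C_ne_zero {s : LTISystem dx du dy} (hdx : 0 < dx) (hs : s.IsMinimal) :
    s.C ≠ 0 := by
  intro hC
  have h : s.observabilityMatrix = 0 := by
    ext i j
    simp [observabilityMatrix, hC]
  have := hs.2
  rw [h, Matrix.rank_zero] at this
  omega

/-- The scalar change of coordinates `x = a x'`. -/
def scalarGL (dx : ℕ) {a : ℝ} (ha : a ≠ 0) : GL (Fin dx) ℝ :=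
  ⟨a • 1, a⁻¹ • 1, by simp [smul_smul, ha], by simp [smul_smul, ha]⟩

lemma coe_scalarGL {a : ℝ} (ha : a ≠ 0) :
    (scalarGL dx ha : Matrix (Fin dx) (Fin dx) ℝ) = a • 1 := rfl

lemma coe_inv_scalarGL {a : ℝ} (ha : a ≠ 0) :
    (↑(scalarGL dx ha)⁻¹ : Matrix (Fin dx) (Fin dx) ℝ) = a⁻¹ • 1 := rfl

/-- The action of the scalar change of coordinates on the dynamics parameter. -/
def dynWeight (dx du dy : ℕ) (a : ℝ) : DynIndex dx du dy → ℝ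
  | .inl _ => 1
  | .inr (.inl _) => a⁻¹
  | .inr (.inr (.inl _)) => a
  | .inr (.inr (.inr _)) => 1

/-- The action of the scalar change of coordinates on the complete standard parameter. -/
def stdWeight (dx du dy : ℕ) (a : ℝ) : StdIndex dx du dy → ℝ
  | .inl i => dynWeight dx du dy a i
  | .inr (.inl _) => a⁻¹
  | .inr (.inr (.inl _)) => a⁻¹
  | .inr (.inr (.inr _)) => 1

/-- The scalar `a` multiplies the latent covariances by `a⁻²`. It therefore gives a symmetry at
fixed covariances when these are zero, or when `a = -1`. -/
lemma dynSystem_dynWeight_mul (P₀ Q : Matrix (Fin dx) (Fin dx) ℝ) (R : Matrix (Fin dy) (Fin dy) ℝ)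
    {a : ℝ} (ha : a ≠ 0) (θ : DynIndex dx du dy → ℝ) :
    dynSystem ((a⁻¹ * a⁻¹) • P₀) ((a⁻¹ * a⁻¹) • Q) R (dynWeight dx du dy a * θ) =
      (dynSystem P₀ Q R θ).similar (scalarGL dx ha) := by
  rw [LTISystem.similar, coe_scalarGL, coe_inv_scalarGL]
  simp only [dynSystem, LTISystem.mk.injEq]
  refine ⟨?_, ?_, ?_, ?_, ?_, ?_, trivial⟩
  all_goals
    ext i j
    simp [dynWeight, ha, mul_assoc]

lemma stdSystem_stdWeight_mul {a : ℝ} (ha : a ≠ 0) (θ : StdIndex dx du dy → ℝ) :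
    stdSystem (stdWeight dx du dy a * θ) = (stdSystem θ).similar (scalarGL dx ha) := by
  have h1 : stdLP (stdWeight dx du dy a * θ) = a⁻¹ • stdLP θ :=
    lowerMatrix_smul a⁻¹ fun p => θ (.inr (.inl p))
  have h2 : stdLQ (stdWeight dx du dy a * θ) = a⁻¹ • stdLQ θ :=
    lowerMatrix_smul a⁻¹ fun p => θ (.inr (.inr (.inl p)))
  have h3 : stdLR (stdWeight dx du dy a * θ) = stdLR θ := by
    simp [stdLR, stdWeight]
  rw [stdSystem, stdSystem, ← dynSystem_dynWeight_mul _ _ _ ha, h1, h2, h3]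
  congr 1 <;> simp [smul_smul]

/-- The coordinatewise multiplication by a vector with nonzero entries. -/
def diagEquiv {ι : Type*} [Fintype ι] (d : ι → ℝ) (hd : ∀ i, d i ≠ 0) : (ι → ℝ) ≃L[ℝ] (ι → ℝ) :=
  (LinearEquiv.piCongrRight fun i =>
    LinearEquiv.smulOfNeZero ℝ ℝ (d i) (hd i)).toContinuousLinearEquiv

lemma diagEquiv_apply {ι : Type*} [Fintype ι] (d : ι → ℝ) (hd : ∀ i, d i ≠ 0) (θ : ι → ℝ) :
    diagEquiv d hd θ = d * θ := rfl

lemma dynWeight_ne_zero {a : ℝ} (ha : a ≠ 0) (i : DynIndex dx du dy) :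
    dynWeight dx du dy a i ≠ 0 := by
  rcases i with p | p | p | p <;> simp [dynWeight, ha]

lemma stdWeight_ne_zero {a : ℝ} (ha : a ≠ 0) (i : StdIndex dx du dy) :
    stdWeight dx du dy a i ≠ 0 := by
  rcases i with i | p | p | p
  · exact dynWeight_ne_zero ha i
  all_goals simp [stdWeight, ha]

lemma continuousAt_dynWeight (i : DynIndex dx du dy) :
    ContinuousAt (fun a => dynWeight dx du dy a i) 1 := by
  rcases i with p | p | p | p <;> simp only [dynWeight] <;> fun_prop (disch := simp)

lemma continuousAt_stdWeight (i : StdIndex dx du dy) :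
    ContinuousAt (fun a => stdWeight dx du dy a i) 1 := by
  rcases i with i | p | p | p
  · exact continuousAt_dynWeight i
  all_goals simp only [stdWeight]; fun_prop (disch := simp)

lemma dynWeight_one : dynWeight dx du dy 1 = 1 := by
  funext i
  rcases i with p | p | p | p <;> simp [dynWeight]

lemma stdWeight_one : stdWeight dx du dy 1 = 1 := by
  funext i
  rcases i with i | p | p | p
  · exact congrFun dynWeight_one i
  all_goals simp [stdWeight]

/-- At `a = 1` the weight is the identity and `K ⊆ U`; compactness of `K` and openness of `U` give
one neighbourhood of `1` that works for all of `K`. -/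
lemma exists_weight_mul_mem {ι : Type*} {d : ℝ → ι → ℝ} (hd : ∀ i, ContinuousAt (fun a => d a i) 1)
    (hd1 : d 1 = 1) {U K : Set (ι → ℝ)} (hU : IsOpen U) (hKU : K ⊆ U) (hK : IsCompact K) :
    ∃ a : ℝ, a ≠ 0 ∧ a ≠ 1 ∧ ∀ θ ∈ K, d a * θ ∈ U := by
  have h : ∀ᶠ a in 𝓝 (1 : ℝ), ∀ θ ∈ K, d a * θ ∈ U := by
    refine hK.eventually_forall_of_forall_eventually fun θ hθ => ?_
    have hc : ContinuousAt (fun q : ℝ × (ι → ℝ) => d q.1 * q.2) (1, θ) := by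
      refine continuousAt_pi.2 fun i => ?_
      refine ContinuousAt.mul ?_ (by fun_prop)
      exact ContinuousAt.comp (f := Prod.fst) (g := fun a => d a i) (hd i) continuousAt_fst
    refine hc.eventually (hU.mem_nhds ?_)
    simpa [hd1] using hKU hθ
  -- Approaching from the right excludes both `0` and the trivial weight `1`.
  have h1 : ∀ᶠ a in 𝓝[>] (1 : ℝ), ∀ θ ∈ K, d a * θ ∈ U := nhdsWithin_le_nhds h
  obtain ⟨a, ha, ha1⟩ := (h1.and self_mem_nhdsWithin).exists
  have ha2 : 1 < a := ha1
  exact ⟨a, by positivity, ha2.ne', ha⟩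

/-- The entries of `C` are multiplied by `a`, and `C` is nonzero by observability, so no minimal
parameter is fixed. -/
lemma dynWeight_mul_ne (hdx : 0 < dx) {P₀ Q : Matrix (Fin dx) (Fin dx) ℝ}
    {R : Matrix (Fin dy) (Fin dy) ℝ} {θ : DynIndex dx du dy → ℝ}
    (hθ : (dynSystem P₀ Q R θ).IsMinimal) {a : ℝ} (ha : a ≠ 1) :
    dynWeight dx du dy a * θ ≠ θ := by
  intro h
  refine hθ.C_ne_zero hdx ?_
  ext i j
  have h1 : a * θ (.inr (.inr (.inl (i, j)))) = θ (.inr (.inr (.inl (i, j)))) :=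
    congrFun h (.inr (.inr (.inl (i, j))))
  have h2 : (a - 1) * θ (.inr (.inr (.inl (i, j)))) = 0 := by linarith
  exact (mul_eq_zero.1 h2).resolve_left (sub_ne_zero.2 ha)

theorem bvMFailsAt_stdSystem (hdx : 0 < dx) {θ₀ : StdIndex dx du dy → ℝ}
    {p : (StdIndex dx du dy → ℝ) → ℝ} (hp : IsPriorDensity (stdParamSpace dx du dy) p)
    {U : Set (StdIndex dx du dy → ℝ)} (hU : IsPriorRegularOn stdSystem p θ₀ U) :
    BvMFailsAt stdSystem p u θ₀ U := by
  refine bvMFailsAt_of_symmetries hp.nonneg hU fun K hKU hK => ?_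
  obtain ⟨a, ha0, ha1, haU⟩ := exists_weight_mul_mem
    continuousAt_stdWeight stdWeight_one hU.isOpen hKU hK
  refine ⟨diagEquiv _ (stdWeight_ne_zero ha0), haU, fun θ hθ h => ?_, fun θ T y => ?_⟩
  · exact dynWeight_mul_ne hdx (hU.minimal θ (hKU hθ)) ha1
      (funext fun i => congrFun h (.inl i))
  · rw [diagEquiv_apply, stdSystem_stdWeight_mul ha0,
      LTISystem.likelihood_similar _ _ (posSemidef_self_mul_transpose _)
        (posSemidef_self_mul_transpose _)]

theorem bvMFailsAt_dynSystem_zero (hdx : 0 < dx) {R : Matrix (Fin dy) (Fin dy) ℝ}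
    {θ₀ : DynIndex dx du dy → ℝ} {p : (DynIndex dx du dy → ℝ) → ℝ}
    (hp : IsPriorDensity Set.univ p) {U : Set (DynIndex dx du dy → ℝ)}
    (hU : IsPriorRegularOn (dynSystem 0 0 R) p θ₀ U) :
    BvMFailsAt (dynSystem 0 0 R) p u θ₀ U := by
  refine bvMFailsAt_of_symmetries hp.nonneg hU fun K hKU hK => ?_
  obtain ⟨a, ha0, ha1, haU⟩ := exists_weight_mul_mem
    continuousAt_dynWeight dynWeight_one hU.isOpen hKU hK
  refine ⟨diagEquiv _ (dynWeight_ne_zero ha0), haU,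
    fun θ hθ => dynWeight_mul_ne hdx (hU.minimal θ (hKU hθ)) ha1, fun θ T y => ?_⟩
  have h := dynSystem_dynWeight_mul 0 0 R ha0 θ
  rw [smul_zero] at h
  rw [diagEquiv_apply, h, LTISystem.likelihood_similar _ _ Matrix.PosSemidef.zero
    Matrix.PosSemidef.zero]

/-- The scalar `-1` preserves all covariances but is not close to the identity, so it cannot be kept
inside `U` by compactness; invariance of `U` under `signFlip` takes over that role. -/
theorem bvMFailsAt_dynSystem (hdx : 0 < dx) {P₀ Q : Matrix (Fin dx) (Fin dx) ℝ}
    {R : Matrix (Fin dy) (Fin dy) ℝ} (hP : P₀.PosSemidef) (hQ : Q.PosSemidef)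
    {θ₀ : DynIndex dx du dy → ℝ} {p : (DynIndex dx du dy → ℝ) → ℝ}
    (hp : IsPriorDensity Set.univ p) {U : Set (DynIndex dx du dy → ℝ)}
    (hU : IsPriorRegularOn (dynSystem P₀ Q R) p θ₀ U) (hflip : ∀ θ ∈ U, signFlip θ ∈ U) :
    BvMFailsAt (dynSystem P₀ Q R) p u θ₀ U := by
  have hneg : (-1 : ℝ) ≠ 0 := by norm_num
  have hw : ∀ θ : DynIndex dx du dy → ℝ, dynWeight dx du dy (-1) * θ = signFlip θ := fun θ => by
    funext i
    rcases i with i | i | i | i <;> simp [dynWeight, signFlip, inv_neg]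
  refine bvMFailsAt_of_symmetries hp.nonneg hU fun K hKU _ =>
    ⟨diagEquiv _ (dynWeight_ne_zero hneg), fun θ hθ => ?_,
      fun θ hθ => dynWeight_mul_ne hdx (hU.minimal θ (hKU hθ)) (by norm_num), fun θ T y => ?_⟩
  · rw [diagEquiv_apply, hw]
    exact hflip θ (hKU hθ)
  · have h := dynSystem_dynWeight_mul P₀ Q R hneg θ
    rw [show ((-1 : ℝ)⁻¹ * (-1)⁻¹) = 1 by norm_num, one_smul, one_smul] at h
    rw [diagEquiv_apply, h, LTISystem.likelihood_similar _ _ hP hQ]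

end Standard

end

theorem theorem5p5 {dx du dy : ℕ} (hdx : 0 < dx) (u : ℕ → Fin du → ℝ) :
    -- the likelihood is constant along similarity orbits
    (∀ (s : LTISystem dx du dy), s.P₀.PosSemidef → s.Q.PosSemidef → s.R.PosDef →
      ∀ (g : GL (Fin dx) ℝ) (T : ℕ) (y : Fin T → Fin dy → ℝ),
        (s.similar g).likelihood u T y = s.likelihood u T y) ∧
    -- the complete standard parameterization, with unknown noise covariances
    (∀ θ₀ ∈ stdParamSpace dx du dy, (stdSystem θ₀).IsMinimal →
      FisherRegularAt stdSystem u θ₀ ∧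
      FisherSingularAt stdSystem u θ₀ (dx ^ 2) ∧
      ∀ p, IsPriorDensity (stdParamSpace dx du dy) p →
        ∀ U, IsPriorRegularOn stdSystem p θ₀ U → BvMFailsAt stdSystem p u θ₀ U) ∧
    -- the parameterization by all entries of the dynamics matrices, with known noise covariances
    (∀ (R : Matrix (Fin dy) (Fin dy) ℝ), R.PosDef →
      -- deterministic state dynamics
      (∀ θ₀ : DynIndex dx du dy → ℝ, (dynSystem 0 0 R θ₀).IsMinimal →
        FisherRegularAt (dynSystem 0 0 R) u θ₀ ∧
        FisherSingularAt (dynSystem 0 0 R) u θ₀ (dx ^ 2) ∧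
        ∀ p, IsPriorDensity Set.univ p →
          ∀ U, IsPriorRegularOn (dynSystem 0 0 R) p θ₀ U →
            BvMFailsAt (dynSystem 0 0 R) p u θ₀ U) ∧
      -- arbitrary known noise covariances
      (∀ (P₀ Q : Matrix (Fin dx) (Fin dx) ℝ), P₀.PosSemidef → Q.PosSemidef →
        ∀ θ₀ : DynIndex dx du dy → ℝ, (dynSystem P₀ Q R θ₀).IsMinimal →
          ∀ p, IsPriorDensity Set.univ p →
            ∀ U, IsPriorRegularOn (dynSystem P₀ Q R) p θ₀ U → (∀ θ ∈ U, signFlip θ ∈ U) →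
              BvMFailsAt (dynSystem P₀ Q R) p u θ₀ U)) := by
  refine ⟨fun s hP hQ _ g T y => s.likelihood_similar u hP hQ g T y, fun θ₀ hθ hmin =>
    ⟨(isSmoothAt_stdSystem hθ).fisherRegularAt u, fisherSingularAt_stdSystem u hdx hθ hmin,
      fun p hp U hU => bvMFailsAt_stdSystem u hdx hp hU⟩, fun R hR => ⟨fun θ₀ hmin =>
    ⟨(isSmoothAt_dynSystem Matrix.PosSemidef.zero Matrix.PosSemidef.zero hR θ₀).fisherRegularAt u,
      fisherSingularAt_dynSystem u hdx hR hmin,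
      fun p hp U hU => bvMFailsAt_dynSystem_zero u hdx hp hU⟩,
    fun P₀ Q hP hQ θ₀ _ p hp U hU hflip => bvMFailsAt_dynSystem u hdx hP hQ hp hU hflip⟩⟩
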